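/- **Problem.** An instance $I$ of the adwords problem has bidders $A=\{1,\dots,m\}$ with budgets $B_j\in\mathbb Z_{>0}$ and queries $1,\dots,n$ arriving in this (adversarially chosen) order. Each edge $(i,j)\in E$ carries a bid $\mathrm{bid}(i,j)\in\mathbb Z_{>0}$ of bidder $j$ for query $i$, with $\mathrm{bid}(i,j)\le B_j$. Write $n(I)=n$ and $$\mu(I)=\max_{(i,j)\in E}\frac{\mathrm{bid}(i,j)-1}{B_j}$$ ($0$ if $E=\emptyset$). Let $w(P)$ be the maximum total bid of an offline assignment $P$ of each query to at most one interested bidder, in which the bids assigned to each $j$ sum to at most $B_j$; $I$ is *complete* if $w(P)=\sum_j B_j$. A family $\mathcal F$ of instances is a *SMALL family* if $\mu(I)\to 0$ as $n(I)\to\infty$, $I\in\mathcal F$. **Online algorithms.** A randomized online algorithm knows the bidders, the budgets and its random seed (drawn after the instance has been fixed); when a query arrives with its bids, it irrevocably picks at most one bidder for it. If $j$ is picked for $i$ and has leftover budget $L_j$ (initially $B_j$), then $\min\{L_j,\mathrm{bid}(i,j)\}$ is paid in real money and subtracted from $L_j$, and $\max\{0,\mathrm{bid}(i,j)-L_j\}$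 is paid in fake money. Let $W$ and $W_f$ be the total real and fake money. The algorithm is *$c$-competitive* on $\mathcal F$ if for every $\varepsilon>0$ there is $N$ with $\mathbb E[W]\ge (c-\varepsilon)\,w(P)$ for all $I\in\mathcal F$ with $n(I)\ge N$. It is *budget-oblivious* if, for a given seed, its picks depend only on the bids seen so far and on which bidders had budget left at the present and at the earlier arrivals. **Algorithm $\mathcal A_3$.** Independently for each $j$, pick $w_j$ uniformly from $[0,1]$ and set $p_j=e^{w_j-1}$. When query $i$ arrives, each $j$ with $(i,j)\in E$ and $L_j>0$ offers the effective bid $\mathrm{bid}(i,j)(1-p_j)$; the query goes to a bidder with the largest effective bid (ties to the smallest index), if there is an offer. **No-Surpassing property of $I$.** For almost every choice of $(w_k)_{k\in A}$ and every edge $(i,j)$: if $\mathrm{bid}(i,j)(1-p_j)$ is larger than every effective bid offered to $i$ in the run of $\mathcal A_3$ on $I$ with bidder $j$ removed (same prices), then no effective bid offered to $i$ in the run on $I$ exceeds $\mathrm{bid}(i,j)(1-p_j)$. **Theorem.** Restricted to instances with the No-Surpassing property, $\mathcal A_3$ is an optimal online algorithm for SMALL, and it is budget-oblivious. That is: 1.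 $\mathcal A_3$ is $(1-\frac1e)$-competitive on every SMALL family all of whose instances have the No-Surpassing property. 2. If a randomized online algorithm is $c$-competitive on every SMALL family whose instances are complete and have the No-Surpassing property, then $c\le 1-\frac1e$. 3. $\mathcal A_3$ is budget-oblivious. 4. In every run of $\mathcal A_3$ on any instance $I$, $W_f\le\mu(I)\sum_j B_j$; in particular $W_f\le \mu(I)\,w(P)$ if $I$ is complete. -/

import Mathlib

open MeasureTheory

universe u

namespace Adwords

/-- An instance of the general adwords problem. Bidders are `Fin m`. Queries are `Fin n`,
numbered in the (adversarial) order of their arrival. Bids and budgets are positive integers: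
`bid i j = 0` encodes that bidder `j` is not interested in query `i`, i.e. that `(i, j)` is not an
edge. No bid of a bidder exceeds his budget. -/
structure Problem where
  m : ℕ
  n : ℕ
  budget : Fin m → ℕ
  bid : Fin n → Fin m → ℕ
  budget_pos : ∀ j, 0 < budget j
  bid_le_budget : ∀ i j, bid i j ≤ budget j

namespace Problem

/-- The queries in order of arrival, each given by the vector of its bids. -/
def queries (I : Problem) : List (Fin I.m → ℕ) := List.ofFn I.bid

/-- The largest value of `(bid (i, j) - 1) / B_j` over all edges `(i, j)` (and `0` if there is no
edge). On an edge the bid is at least `1`, so the natural-number subtraction is exact. -/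
noncomputable def mu (I : Problem) : NNReal :=
  (Finset.univ.filter fun e : Fin I.n × Fin I.m => 0 < I.bid e.1 e.2).sup
    fun e => ((I.bid e.1 e.2 - 1 : ℕ) : NNReal) / (I.budget e.2 : NNReal)

/-- An offline solution: every query goes to at most one bidder, who is interested in it, and the
total weight at every bidder is at most his budget. -/
def Feasible (I : Problem) (a : Fin I.n → Option (Fin I.m)) : Prop :=
  (∀ i j, a i = some j → 0 < I.bid i j) ∧
    ∀ j, ∑ i, (if a i = some j then I.bid i j else 0) ≤ I.budget j

/-- The total weight of an offline solution. -/
def weight (I : Problem) (a : Fin I.n → Option (Fin I.m)) : ℕ :=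
  ∑ j, ∑ i, (if a i = some j then I.bid i j else 0)

open Classical in
/-- The largest weight `w(P)` of an offline solution. -/
noncomputable def opt (I : Problem) : ℕ :=
  (Finset.univ.filter fun a => I.Feasible a).sup I.weight

/-- The offline optimum spends all budgets in full. -/
def Complete (I : Problem) : Prop := I.opt = ∑ j, I.budget j

end Problem

/-- What is known at the arrival of a query: its bids, and the leftover budgets at that time. -/
structure Arrival (m : ℕ) where
  bids : Fin m → ℕ
  left : Fin m → ℕ

/-- The part of an `Arrival` that does not reveal budgets: the bids, and for every bidder only
whether he has budget left. -/
def Arrival.observed {m : ℕ} (a : Arrival m) : (Fin m → ℕ) × Set (Fin m) :=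
  (a.bids, {j | 0 < a.left j})

/-- A randomized online algorithm for the adwords problem. The `m` bidders and their budgets are
known up-front, then a random seed is drawn. At the arrival of a query, the algorithm irrevocably
picks at most one bidder for it, knowing the budgets, the seed, the earlier arrivals (latest first)
and the present one, and nothing about later queries. -/
structure OnlineAlgorithm where
  Seed : ℕ → Type u
  measurableSeed : ∀ m, MeasurableSpace (Seed m)
  law : ∀ m, Measure (Seed m)
  probability : ∀ m, IsProbabilityMeasure (law m)
  pick : ∀ {m : ℕ}, (Fin m → ℕ) → Seed m → List (Arrival m) → Arrival m → Option (Fin m)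
  measurableSet_pick : ∀ {m : ℕ} (B : Fin m → ℕ) (past : List (Arrival m)) (a : Arrival m)
    (o : Option (Fin m)), MeasurableSet {ω | pick B ω past a = o}

attribute [instance] OnlineAlgorithm.measurableSeed OnlineAlgorithm.probability

/-- The state of a run: the arrivals so far (latest first), the leftover budgets `L`, the real money
`W` and the fake money `W_f` spent so far. -/
structure State (m : ℕ) where
  past : List (Arrival m)
  left : Fin m → ℕ
  real : ℕ
  fake : ℕ

/-- The state before the first query. -/
def State.init {m : ℕ} (B : Fin m → ℕ) : State m := ⟨[], B, 0, 0⟩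

/-- A query with bids `q` arrives and goes to bidder `o` (or stays unmatched). Bidder `j` pays
`min L_j (bid j)` of real money; the rest of his bid (truncated subtraction) is fake money. -/
def State.charge {m : ℕ} (s : State m) (q : Fin m → ℕ) (o : Option (Fin m)) : State m :=
  match o with
  | none => { s with past := ⟨q, s.left⟩ :: s.past }
  | some j =>
    { past := ⟨q, s.left⟩ :: s.past
      left := Function.update s.left j (s.left j - min (s.left j) (q j))
      real := s.real + min (s.left j) (q j)
      fake := s.fake + (q j - s.left j) }

namespace OnlineAlgorithm

variable (A : OnlineAlgorithm.{u})

/-- The state after the queries `qs` (in order of arrival), for budgets `B` and seed `ω`. -/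
def run {m : ℕ} (B : Fin m → ℕ) (ω : A.Seed m) (qs : List (Fin m → ℕ)) : State m :=
  qs.foldl (fun s q => s.charge q (A.pick B ω s.past ⟨q, s.left⟩)) (State.init B)

/-- The expected real money spent, over the random seed, on the instance `I`. -/
noncomputable def expectedRevenue (I : Problem) : ℝ :=
  ∫ ω, ((A.run I.budget ω I.queries).real : ℝ) ∂(A.law I.m)

/-- On the instances of `𝓕`, the competitive ratio is at least `c` as the number of queries tends to
infinity. -/
def CompetitiveOn (𝓕 : Set Problem) (c : ℝ) : Prop :=
  ∀ ε > (0 : ℝ), ∃ N : ℕ, ∀ I ∈ 𝓕, N ≤ I.n → (c - ε) * (I.opt : ℝ) ≤ A.expectedRevenue I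

/-- For every seed, the picks depend only on the bids seen so far and on which bidders have (had)
budget left at the present and at the earlier arrivals, not on the budgets or the amounts left. -/
def BudgetOblivious : Prop :=
  ∀ (m : ℕ) (B B' : Fin m → ℕ) (ω : A.Seed m) (past past' : List (Arrival m)) (a a' : Arrival m),
    past.map Arrival.observed = past'.map Arrival.observed → a.observed = a'.observed →
      A.pick B ω past a = A.pick B' ω past' a'

end OnlineAlgorithm

/-- A family of instances of SMALL: `mu I → 0` as the number of queries of `I ∈ 𝓕` tends to
infinity. -/
def IsSmall (𝓕 : Set Problem) : Prop :=
  ∀ ε > (0 : ℝ), ∃ N : ℕ, ∀ I ∈ 𝓕, N ≤ I.n → (I.mu : ℝ) ≤ ε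

/-- `A` has asymptotic competitive ratio at least `c` for SMALL, restricted to instances in `C`. -/
def OnlineAlgorithm.CompetitiveForSmall (A : OnlineAlgorithm.{u}) (C : Set Problem) (c : ℝ) :
    Prop :=
  ∀ 𝓕 ⊆ C, IsSmall 𝓕 → A.CompetitiveOn 𝓕 c

/-- The effective bid `bid * (1 - p)`, where the price is `p = exp (w - 1)` for the rank `w`. -/
noncomputable def ebid {m : ℕ} (w : Fin m → unitInterval) (q : Fin m → ℕ) (j : Fin m) : ℝ :=
  (q j : ℝ) * (1 - Real.exp ((w j : ℝ) - 1))

/-- Bidder `j` offers a bid: he is interested in the query and has budget left. -/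
def Offers {m : ℕ} (q L : Fin m → ℕ) (j : Fin m) : Prop := 0 < q j ∧ 0 < L j

/-- Bidder `j` offers a bid, and no effective bid on offer is larger than his. -/
def IsBest {m : ℕ} (w : Fin m → unitInterval) (q L : Fin m → ℕ) (j : Fin m) : Prop :=
  Offers q L j ∧ ∀ k, Offers q L k → ebid w q k ≤ ebid w q j

open Classical in
/-- The bidder with the largest effective bid on offer, if there is any offer. Ties, which have
probability zero, go to the smallest index. -/
noncomputable def bestBidder {m : ℕ} (w : Fin m → unitInterval) (q L : Fin m → ℕ) :
    Option (Fin m) :=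
  (List.finRange m).find? fun j => decide (IsBest w q L j)

theorem measurableSet_isBest {m : ℕ} (q L : Fin m → ℕ) (j : Fin m) :
    MeasurableSet {w : Fin m → unitInterval | IsBest w q L j} := by
  have hm : ∀ k, Measurable fun w : Fin m → unitInterval => ebid w q k := by
    intro k
    unfold ebid
    fun_prop
  unfold IsBest
  simp only [Set.ofPred_and, Set.ofPred_forall]
  exact (MeasurableSet.const _).inter
    (MeasurableSet.iInter fun k => MeasurableSet.iInter fun _ => measurableSet_le (hm k) (hm j))

theorem measurableSet_bestBidder {m : ℕ} (q L : Fin m → ℕ) (o : Option (Fin m)) :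
    MeasurableSet {w : Fin m → unitInterval | bestBidder w q L = o} := by
  classical
  have h : {w : Fin m → unitInterval | bestBidder w q L = o} =
      ⋃ (S : Set (Fin m)) (_ : ((List.finRange m).find? fun j => decide (j ∈ S)) = o),
        ⋂ j, {w | IsBest w q L j ↔ j ∈ S} := by
    ext w
    simp only [Set.mem_ofPred_eq, Set.mem_iUnion, Set.mem_iInter, exists_prop, bestBidder]
    constructor
    · intro hw
      exact ⟨{j | IsBest w q L j}, by simpa using hw, fun j => by simp⟩
    · rintro ⟨S, hS, hw⟩
      rw [← hS]
      congr 1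
      funext j
      simp [hw j]
  rw [h]
  refine MeasurableSet.iUnion fun S => MeasurableSet.iUnion fun _ => MeasurableSet.iInter fun j => ?_
  by_cases hj : j ∈ S
  · simpa [hj] using measurableSet_isBest q L j
  · simpa [hj, Set.compl_def] using (measurableSet_isBest q L j).compl

/-- The algorithm `A_3`: the ranks of the bidders are independent and uniform on `[0, 1]`, and every
query accepts the largest effective bid it is offered. -/
noncomputable def algorithmA3 : OnlineAlgorithm.{0} where
  Seed m := Fin m → unitInterval
  measurableSeed _ := inferInstance
  law _ := volume
  probability _ := inferInstance
  pick _ w _ a := bestBidder w a.bids a.left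
  measurableSet_pick _ _ a o := measurableSet_bestBidder a.bids a.left o

/-- The No-Surpassing property of an instance `I`. For almost all ranks, the following holds for
every edge `(i, j)`: if the effective bid of `j` for `i` is better than every bid that `i` is offered
in the run of `A_3` without bidder `j` (with the same ranks), then no bid that `i` is offered in the
run on `I` surpasses it. Bidder `j` is removed by deleting his edges. -/
def Problem.NoSurpassing (I : Problem) : Prop :=
  ∀ᵐ w : Fin I.m → unitInterval, ∀ (i : Fin I.n) (j : Fin I.m), 0 < I.bid i j →
    (∀ k, k ≠ j →
      Offers (I.bid i)
        (algorithmA3.run I.budget w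
          ((I.queries.take i).map fun q => Function.update q j 0)).left k →
      ebid w (I.bid i) k < ebid w (I.bid i) j) →
    ∀ k, Offers (I.bid i) (algorithmA3.run I.budget w (I.queries.take i)).left k →
      ebid w (I.bid i) k ≤ ebid w (I.bid i) j

end Adwords

/-!
**The ratio of `algorithmA3`.** An accepted bid `b` of bidder `j` splits into a revenue `b * p_j`
of the bidder and a utility `b * (1 - p_j)` of the query, so it suffices to bound the revenues and
the utilities along an optimal offline solution. Fix `j` and all ranks but that of `j`, and run
the algorithm without `j`. Its outcome sets for every query `i` a threshold `g`, the utility of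
`i` in that run. The presence of `j` leaves the other bidders with at least as much budget at any
time (`left_run_update_le`), so the utility of `i` in the actual run is at least `g`. If
`b * (1 - p_j) > g` for the bid `b` of `j` for `i`, then the No-Surpassing property says that
nobody outbids `j` on `i`, and ties have probability zero (`ae_ebid_ne`), so that `i` goes to `j`
unless `j` is exhausted. Either way the accepted bids of `j` sum to at least the bids on his
offline queries whose thresholds he beats (`Problem.sum_beaten_le_accepted`). Integrating over the
rank of `j` alone gives at least `b * (1 - 1/e)` for revenue plus threshold on each offline edge
(`integral_revenue_add_threshold_ge`). Hence the expected real and fake money together amount to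
at least `1 - 1/e` times the optimum. Only an exhausted bidder has paid fake money, once, and at
most `mu` times his budget, all of which he has spent in real money. So the fake money is at most
`mu` times the real money (`Problem.fake_le_mu_mul_real`), and negligible in the limit, whether or
not the instance is complete.

**The upper bound.** Unit bids and unit budgets have `mu = 0`, and they satisfy the No-Surpassing
property (`noSurpassing_of_unit`), so the worst case of online bipartite matching is available.
The algorithm being given, the adversary knows the expected spending of every bidder. He opens
every query to all active bidders, and then withdraws the one with the least expected spending.
Let `D t` be the expected spending of the `t` bidders withdrawn first among `n + 1`, and `r` that
of the next one. After `t + 1` queries at most `t + 1` has been spent, so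
`D t + (n + 1 - t) * r ≤ t + 1` (`OnlineAlgorithm.withdrawnLoad_add_le`). Solving this recursion
until about `n / e` bidders are active, and counting at most one unit for each of these, bounds
the revenue by `(1 - 1/e) n + o(n)`. The withdrawn bidders in turn form a perfect matching, so the
offline optimum is `n + 1`. No randomization over instances is needed.
-/

namespace Adwords

/-! ### Runs of an online algorithm -/

instance countableArrival {m : ℕ} : Countable (Arrival m) :=
  Function.Injective.countable (f := fun a : Arrival m => (a.bids, a.left))
    (by rintro ⟨⟩ ⟨⟩ h; simpa using h)

instance countableState {m : ℕ} : Countable (State m) :=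
  Function.Injective.countable (f := fun s : State m => (s.past, s.left, s.real, s.fake))
    (by rintro ⟨⟩ ⟨⟩ h; simpa using h)

namespace State

variable {m : ℕ} (s : State m) (q : Fin m → ℕ) (o : Option (Fin m))

theorem left_charge (k : Fin m) :
    (s.charge q o).left k = s.left k - if o = some k then q k else 0 := by
  cases o with
  | none => simp [charge]
  | some j =>
    by_cases h : k = j
    · subst h; simp [charge]; omega
    · simp [charge, h, Ne.symm h]

theorem left_charge_le (k : Fin m) : (s.charge q o).left k ≤ s.left k := by
  rw [left_charge]; exact Nat.sub_le _ _

theorem real_charge_add_sum_left :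
    (s.charge q o).real + ∑ k, (s.charge q o).left k = s.real + ∑ k, s.left k := by
  cases o with
  | none => simp [charge]
  | some j =>
    have h := Finset.sum_update_of_mem (Finset.mem_univ j) s.left
      (s.left j - min (s.left j) (q j))
    have h' := Finset.add_sum_erase Finset.univ s.left (Finset.mem_univ j)
    rw [Finset.sdiff_singleton_eq_erase] at h
    simp only [charge]
    rw [h]
    omega

theorem real_charge_add_fake :
    (s.charge q o).real + (s.charge q o).fake =
      s.real + s.fake + ∑ j, if o = some j then q j else 0 := by
  cases o with
  | none => simp [charge]
  | some j => simp [charge]; omega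

theorem real_charge_le {b : ℕ} (hq : ∀ j, q j ≤ b) : (s.charge q o).real ≤ s.real + b := by
  cases o with
  | none => simp [charge]
  | some j => have := hq j; simp [charge]; omega

end State

namespace OnlineAlgorithm

variable (A : OnlineAlgorithm.{u}) {m : ℕ} (B : Fin m → ℕ)

theorem run_concat (ω : A.Seed m) (qs : List (Fin m → ℕ)) (q : Fin m → ℕ) :
    A.run B ω (qs ++ [q]) = (A.run B ω qs).charge q
      (A.pick B ω (A.run B ω qs).past ⟨q, (A.run B ω qs).left⟩) := by
  simp [run]

theorem real_run_add_sum_left (ω : A.Seed m) (qs : List (Fin m → ℕ)) :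
    (A.run B ω qs).real + ∑ k, (A.run B ω qs).left k = ∑ k, B k := by
  induction qs using List.reverseRecOn with
  | nil => simp [run, State.init]
  | append_singleton qs q ih => rw [run_concat, State.real_charge_add_sum_left, ih]

theorem left_run_le (ω : A.Seed m) (qs : List (Fin m → ℕ)) (k : Fin m) :
    (A.run B ω qs).left k ≤ B k := by
  induction qs using List.reverseRecOn with
  | nil => simp [run, State.init]
  | append_singleton qs q ih => rw [run_concat]; exact (State.left_charge_le _ _ _ _).trans ih

/-- The real money spent is what is missing from the budgets. -/
theorem real_run_eq_sum (ω : A.Seed m) (qs : List (Fin m → ℕ)) :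
    ((A.run B ω qs).real : ℝ) = ∑ k, ((B k : ℝ) - (A.run B ω qs).left k) := by
  have h := A.real_run_add_sum_left B ω qs
  rw [Finset.sum_sub_distrib, eq_sub_iff_add_eq]
  exact_mod_cast h

theorem real_run_le (ω : A.Seed m) {b : ℕ} (qs : List (Fin m → ℕ))
    (hb : ∀ q ∈ qs, ∀ j, q j ≤ b) : (A.run B ω qs).real ≤ qs.length * b := by
  induction qs using List.reverseRecOn with
  | nil => simp [run, State.init]
  | append_singleton qs q ih =>
    rw [run_concat]
    have h1 := State.real_charge_le (A.run B ω qs) q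
      (A.pick B ω (A.run B ω qs).past ⟨q, (A.run B ω qs).left⟩) (hb q (by simp))
    have h2 := ih fun r hr => hb r (by simp [hr])
    simp only [List.length_append, List.length_singleton]
    linarith

theorem measurableSet_run_eq (qs : List (Fin m → ℕ)) (s : State m) :
    MeasurableSet {ω | A.run B ω qs = s} := by
  induction qs using List.reverseRecOn generalizing s with
  | nil => exact MeasurableSet.const (State.init B = s)
  | append_singleton qs q ih =>
    have h : {ω | A.run B ω (qs ++ [q]) = s} =
        ⋃ (s₀ : State m) (o : Option (Fin m)) (_ : s₀.charge q o = s),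
          {ω | A.run B ω qs = s₀} ∩ {ω | A.pick B ω s₀.past ⟨q, s₀.left⟩ = o} := by
      ext ω
      simp [run_concat]
    rw [h]
    exact MeasurableSet.iUnion fun s₀ => MeasurableSet.iUnion fun o => MeasurableSet.iUnion fun _ =>
      (ih s₀).inter (A.measurableSet_pick B _ _ o)

/-- Runs take countably many values, each on a measurable set of seeds, so every quantity that is
read off the state of a run is measurable. -/
theorem measurable_comp_run {β : Type*} [MeasurableSpace β] (qs : List (Fin m → ℕ))
    (F : State m → β) : Measurable fun ω => F (A.run B ω qs) := by
  let _ : MeasurableSpace (State m) := ⊤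
  have h : Measurable fun ω => A.run B ω qs :=
    measurable_to_countable' fun s => A.measurableSet_run_eq B qs s
  exact measurable_from_top.comp h

theorem measurableSet_pick_run (qs : List (Fin m → ℕ)) (q : Fin m → ℕ) (o : Option (Fin m)) :
    MeasurableSet
      {ω | A.pick B ω (A.run B ω qs).past ⟨q, (A.run B ω qs).left⟩ = o} := by
  have h : {ω | A.pick B ω (A.run B ω qs).past ⟨q, (A.run B ω qs).left⟩ = o} =
      ⋃ s₀ : State m,
        {ω | A.run B ω qs = s₀} ∩ {ω | A.pick B ω s₀.past ⟨q, s₀.left⟩ = o} := by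
    ext ω
    simp
  rw [h]
  exact MeasurableSet.iUnion fun s₀ =>
    (A.measurableSet_run_eq B qs s₀).inter (A.measurableSet_pick B _ _ o)

theorem integrable_left_run (qs : List (Fin m → ℕ)) (k : Fin m) :
    Integrable (fun ω => ((A.run B ω qs).left k : ℝ)) (A.law m) := by
  refine Integrable.of_bound
    (A.measurable_comp_run B qs fun s => (s.left k : ℝ)).aestronglyMeasurable (B k)
    (Filter.Eventually.of_forall fun ω => ?_)
  simpa using A.left_run_le B ω qs k

theorem integrable_real_run (qs : List (Fin m → ℕ)) :
    Integrable (fun ω => ((A.run B ω qs).real : ℝ)) (A.law m) := by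
  simp_rw [real_run_eq_sum]
  exact integrable_finsetSum _ fun k _ => (integrable_const _).sub (A.integrable_left_run B qs k)

end OnlineAlgorithm

/-! ### The instance query by query -/

namespace Problem

variable (I : Problem)

theorem take_succ_queries (i : Fin I.n) :
    I.queries.take (i + 1) = I.queries.take i ++ [I.bid i] := by
  have h : (i : ℕ) < I.queries.length := by simp [queries]
  rw [← List.take_concat_get' _ _ h]
  simp [queries]

theorem take_length_queries : I.queries.take I.n = I.queries := by
  rw [List.take_of_length_le]; simp [queries]

theorem mu_ge (i : Fin I.n) (j : Fin I.m) (h : 0 < I.bid i j) :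
    (I.bid i j : ℝ) - 1 ≤ I.mu * I.budget j := by
  have h1 : ((I.bid i j - 1 : ℕ) : NNReal) / (I.budget j : NNReal) ≤ I.mu := by
    unfold mu
    exact Finset.le_sup
      (f := fun e : Fin I.n × Fin I.m =>
        ((I.bid e.1 e.2 - 1 : ℕ) : NNReal) / (I.budget e.2 : NNReal)) (b := (i, j))
      (by simpa using h)
  have hB : (0 : NNReal) < I.budget j := by exact_mod_cast I.budget_pos j
  rw [div_le_iff₀ hB] at h1
  have h2 : (((I.bid i j - 1 : ℕ) : NNReal) : ℝ) ≤
      ((I.mu * (I.budget j : NNReal) : NNReal) : ℝ) := by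
    exact_mod_cast h1
  rw [NNReal.coe_natCast, NNReal.coe_mul, NNReal.coe_natCast, Nat.cast_sub h] at h2
  simpa using h2

theorem exists_feasible_weight_eq_opt : ∃ a, I.Feasible a ∧ I.weight a = I.opt := by
  classical
  have hne : (Finset.univ.filter fun a => I.Feasible a).Nonempty :=
    ⟨fun _ => none, Finset.mem_filter.2 ⟨Finset.mem_univ _, by simp, by simp⟩⟩
  obtain ⟨a, ha, h⟩ := Finset.exists_mem_eq_sup _ hne I.weight
  refine ⟨a, by simpa using ha, ?_⟩
  rw [← h]
  unfold opt
  congr!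

theorem weight_le_opt {a : Fin I.n → Option (Fin I.m)} (ha : I.Feasible a) :
    I.weight a ≤ I.opt := by
  classical
  unfold opt
  exact Finset.le_sup (f := I.weight) (by simpa using ha)

theorem opt_le_sum_budget : I.opt ≤ ∑ j, I.budget j := by
  obtain ⟨a, ha, h⟩ := I.exists_feasible_weight_eq_opt
  rw [← h]
  exact Finset.sum_le_sum fun j _ => ha.2 j

end Problem

theorem sum_fin_telescope (n : ℕ) (F : ℕ → ℝ) : ∑ i : Fin n, (F (i + 1) - F i) = F n - F 0 := by
  rw [Fin.sum_univ_eq_sum_range (fun i => F (i + 1) - F i) n, Finset.sum_range_sub]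

/-! ### The best bidder -/

section Best

variable {m : ℕ} {w : Fin m → unitInterval} {q L q' L' : Fin m → ℕ} {j z : Fin m}

theorem one_sub_price_nonneg (x : unitInterval) : 0 ≤ 1 - Real.exp ((x : ℝ) - 1) := by
  have : Real.exp ((x : ℝ) - 1) ≤ 1 := Real.exp_le_one_iff.2 (by linarith [x.2.2])
  linarith

theorem ebid_nonneg (w : Fin m → unitInterval) (q : Fin m → ℕ) (j : Fin m) : 0 ≤ ebid w q j :=
  mul_nonneg (Nat.cast_nonneg _) (one_sub_price_nonneg _)

theorem ebid_le (w : Fin m → unitInterval) (q : Fin m → ℕ) (j : Fin m) : ebid w q j ≤ q j :=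
  mul_le_of_le_one_right (Nat.cast_nonneg _) (by linarith [Real.exp_pos ((w j : ℝ) - 1)])

theorem ebid_update_ne {k : Fin m} (h : k ≠ j) (b : ℕ) :
    ebid w (Function.update q j b) k = ebid w q k := by
  simp [ebid, h]

theorem bestBidder_eq_some_iff :
    bestBidder w q L = some z ↔ IsBest w q L z ∧ ∀ k < z, ¬ IsBest w q L k := by
  classical
  unfold bestBidder
  rw [List.find?_eq_some_iff_getElem]
  constructor
  · rintro ⟨h, i, hi, rfl, h'⟩
    refine ⟨by simpa using h, fun k hk => ?_⟩
    have := h' k (by simpa [Fin.lt_def] using hk)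
    simpa using this
  · rintro ⟨h, h'⟩
    refine ⟨by simpa using h, z, by simp, by simp, fun k hk => ?_⟩
    simpa using h' ⟨k, by omega⟩ (by simpa [Fin.lt_def] using hk)

theorem isBest_of_bestBidder (h : bestBidder w q L = some z) : IsBest w q L z :=
  (bestBidder_eq_some_iff.1 h).1

theorem exists_bestBidder (h : Offers q L j) : ∃ z, bestBidder w q L = some z := by
  classical
  obtain ⟨z, hz, hmax⟩ := Finset.exists_max_image (Finset.univ.filter fun k => Offers q L k)
    (ebid w q) ⟨j, by simpa using h⟩
  have hbest : IsBest w q L z := ⟨by simpa using hz, fun k hk => hmax k (by simpa using hk)⟩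
  rw [← Option.isSome_iff_exists, bestBidder, List.find?_isSome]
  exact ⟨z, by simp, by simpa using hbest⟩

theorem bestBidder_eq_of_unique (h : IsBest w q L j) (hu : ∀ k, IsBest w q L k → k = j) :
    bestBidder w q L = some j :=
  bestBidder_eq_some_iff.2 ⟨h, fun k hk hb => hk.ne (hu k hb)⟩

/-- Fewer offers: a winner who still offers still wins. The tie-breaking rule is consistent. -/
theorem bestBidder_of_subset (hsub : ∀ k, Offers q' L' k → Offers q L k ∧ q' k = q k)
    (h : bestBidder w q L = some z) (hz : Offers q' L' z) : bestBidder w q' L' = some z := by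
  have he : ∀ k, Offers q' L' k → ebid w q' k = ebid w q k := fun k hk => by
    simp [ebid, (hsub k hk).2]
  rw [bestBidder_eq_some_iff] at h ⊢
  refine ⟨⟨hz, fun k hk => ?_⟩, fun k hkz hk => h.2 k hkz ⟨(hsub k hk.1).1, fun l hl => ?_⟩⟩
  · rw [he k hk, he z hz]; exact h.1.2 k (hsub k hk).1
  · have h1 := hk.2 z hz
    rw [he k hk.1, he z hz] at h1
    exact (h.1.2 l hl).trans h1

theorem bestBidder_congr {w' : Fin m → unitInterval} (h : ebid w q = ebid w' q) :
    bestBidder w q L = bestBidder w' q L := by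
  unfold bestBidder IsBest
  rw [h]

/-- The largest effective bid on offer, and `0` if there is no offer: the utility of the query. -/
noncomputable def bestBid (w : Fin m → unitInterval) (q L : Fin m → ℕ) : ℝ :=
  ∑ k, if bestBidder w q L = some k then ebid w q k else 0

theorem bestBid_of_eq_some (h : bestBidder w q L = some z) : bestBid w q L = ebid w q z := by
  simp [bestBid, h]

theorem bestBid_nonneg : 0 ≤ bestBid w q L :=
  Finset.sum_nonneg fun k _ => by split_ifs; exacts [ebid_nonneg _ _ _, le_rfl]

theorem ebid_le_bestBid (h : Offers q L j) : ebid w q j ≤ bestBid w q L := by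
  obtain ⟨z, hz⟩ := exists_bestBidder (w := w) h
  rw [bestBid_of_eq_some hz]
  exact (isBest_of_bestBidder hz).2 j h

theorem bestBid_le_of_subset (hsub : ∀ k, Offers q' L' k → Offers q L k ∧ q' k = q k) :
    bestBid w q' L' ≤ bestBid w q L := by
  rcases h : bestBidder w q' L' with _ | z
  · simpa [bestBid, h] using bestBid_nonneg (w := w) (q := q) (L := L)
  · have hz := (isBest_of_bestBidder h).1
    have := ebid_le_bestBid (w := w) (hsub z hz).1
    rw [bestBid_of_eq_some h]
    simpa [ebid, (hsub z hz).2] using this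

theorem bestBid_le_sum : bestBid w q L ≤ ∑ k, (q k : ℝ) :=
  Finset.sum_le_sum fun k _ => by
    split_ifs
    exacts [ebid_le _ _ _, Nat.cast_nonneg _]

end Best

/-! ### Runs of `algorithmA3` -/

section RunA3

variable {m : ℕ} (B : Fin m → ℕ) (w : Fin m → unitInterval)

theorem runA3_concat (qs : List (Fin m → ℕ)) (q : Fin m → ℕ) :
    algorithmA3.run B w (qs ++ [q]) = (algorithmA3.run B w qs).charge q
      (bestBidder w q (algorithmA3.run B w qs).left) :=
  algorithmA3.run_concat B w qs q

theorem offers_of_update {q L L' : Fin m → ℕ} {j : Fin m}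
    (hL : ∀ k ≠ j, L' k ≤ L k) (k : Fin m) (hk : Offers (Function.update q j 0) L' k) :
    Offers q L k ∧ Function.update q j 0 k = q k := by
  have hkj : k ≠ j := by
    rintro rfl
    simpa using hk.1
  have h1 := hk.1
  rw [Function.update_of_ne hkj] at h1
  exact ⟨⟨h1, hk.2.trans_le (hL k hkj)⟩, Function.update_of_ne hkj _ _⟩

/-- Monotonicity: at any time, the presence of bidder `j` leaves every other bidder with at least
as much budget as he has in the run without `j`. Another bidder who wins a query in the
presence of `j` also wins it in his absence, unless he has no budget left there. -/
theorem left_run_update_le (j : Fin m) (qs : List (Fin m → ℕ)) :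
    ∀ k ≠ j, (algorithmA3.run B w (qs.map fun q => Function.update q j 0)).left k ≤
      (algorithmA3.run B w qs).left k := by
  induction qs using List.reverseRecOn with
  | nil => exact fun k _ => le_rfl
  | append_singleton qs q ih =>
    intro k hk
    rw [List.map_append, List.map_singleton, runA3_concat, runA3_concat, State.left_charge,
      State.left_charge, Function.update_of_ne hk]
    have hle := ih k hk
    by_cases hz : bestBidder w q (algorithmA3.run B w qs).left = some k
    · by_cases h0 : 0 < (algorithmA3.run B w (qs.map fun q => Function.update q j 0)).left k
      · have hq : 0 < q k := (isBest_of_bestBidder hz).1.1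
        have := bestBidder_of_subset (offers_of_update ih) hz
          ⟨by rwa [Function.update_of_ne hk], h0⟩
        rw [if_pos hz, if_pos this]
        omega
      · omega
    · rw [if_neg hz]
      omega

theorem ebid_update_rank (w : Fin m → unitInterval) (q : Fin m → ℕ) (j : Fin m)
    (x : unitInterval) :
    ebid (Function.update w j x) (Function.update q j 0) = ebid w (Function.update q j 0) := by
  funext k
  by_cases hk : k = j
  · subst hk; simp [ebid]
  · simp [ebid, hk]

/-- The run without bidder `j` does not depend on the rank of `j`. -/
theorem run_update_rank (j : Fin m) (x : unitInterval) (qs : List (Fin m → ℕ)) :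
    algorithmA3.run B (Function.update w j x) (qs.map fun q => Function.update q j 0) =
      algorithmA3.run B w (qs.map fun q => Function.update q j 0) := by
  induction qs using List.reverseRecOn with
  | nil => rfl
  | append_singleton qs q ih =>
    rw [List.map_append, List.map_singleton, runA3_concat, runA3_concat, ih]
    congr 1
    exact bestBidder_congr (ebid_update_rank w q j x)

end RunA3

theorem algorithmA3_budgetOblivious : algorithmA3.BudgetOblivious := by
  intro m B B' w past past' a a' _ h
  have h1 : a.bids = a'.bids := congrArg Prod.fst h
  have h2 : ∀ k, 0 < a.left k ↔ 0 < a'.left k := Set.ext_iff.1 (congrArg Prod.snd h)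
  have hb : IsBest w a.bids a.left = IsBest w a'.bids a'.left := by
    funext j
    simp only [IsBest, Offers, h1, h2]
  change bestBidder w a.bids a.left = bestBidder w a'.bids a'.left
  unfold bestBidder
  rw [hb]

namespace Problem

variable (I : Problem)

/-- The leftover budgets in the run of `algorithmA3` before the query number `t`. -/
noncomputable def leftAt (w : Fin I.m → unitInterval) (t : ℕ) : Fin I.m → ℕ :=
  (algorithmA3.run I.budget w (I.queries.take t)).left

/-- The bid of bidder `j` for query `i` if `algorithmA3` accepts it, and `0` otherwise. It is paid
in real and fake money. -/
noncomputable def accepted (w : Fin I.m → unitInterval) (i : Fin I.n) (j : Fin I.m) : ℕ :=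
  if bestBidder w (I.bid i) (I.leftAt w i) = some j then I.bid i j else 0

/-- The utility of query `i` in the run without bidder `j`: the effective bid that `j` has to
beat. -/
noncomputable def threshold (w : Fin I.m → unitInterval) (i : Fin I.n) (j : Fin I.m) : ℝ :=
  bestBid w (Function.update (I.bid i) j 0)
    (algorithmA3.run I.budget w ((I.queries.take i).map fun q => Function.update q j 0)).left

theorem leftAt_succ (w : Fin I.m → unitInterval) (i : Fin I.n) (j : Fin I.m) :
    I.leftAt w (i + 1) j = I.leftAt w i j - I.accepted w i j := by
  rw [leftAt, take_succ_queries, runA3_concat, State.left_charge]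
  rfl

theorem leftAt_mono (w : Fin I.m → unitInterval) (j : Fin I.m) {s t : ℕ} (h : s ≤ t)
    (ht : t ≤ I.n) : I.leftAt w t j ≤ I.leftAt w s j := by
  induction t, h using Nat.le_induction with
  | base => exact le_rfl
  | succ t hst ih =>
    exact ((I.leftAt_succ w ⟨t, ht⟩ j).trans_le (Nat.sub_le _ _)).trans (ih (by omega))

theorem real_add_fake (w : Fin I.m → unitInterval) :
    ((algorithmA3.run I.budget w I.queries).real : ℝ) +
      (algorithmA3.run I.budget w I.queries).fake = ∑ i, ∑ j, (I.accepted w i j : ℝ) := by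
  have h := sum_fin_telescope I.n fun t =>
    ((algorithmA3.run I.budget w (I.queries.take t)).real : ℝ) +
      (algorithmA3.run I.budget w (I.queries.take t)).fake
  rw [take_length_queries] at h
  have h0 : (algorithmA3.run I.budget w (I.queries.take 0)) = State.init I.budget := rfl
  simp only [h0, State.init, Nat.cast_zero, add_zero, sub_zero] at h
  rw [← h]
  refine Finset.sum_congr rfl fun i _ => ?_
  have h1 := State.real_charge_add_fake (algorithmA3.run I.budget w (I.queries.take i)) (I.bid i)
    (bestBidder w (I.bid i) (I.leftAt w i))
  rw [leftAt, ← runA3_concat, ← take_succ_queries] at h1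
  have h2 : (((algorithmA3.run I.budget w (I.queries.take (i + 1))).real : ℝ) +
      (algorithmA3.run I.budget w (I.queries.take (i + 1))).fake) =
      (algorithmA3.run I.budget w (I.queries.take i)).real +
      (algorithmA3.run I.budget w (I.queries.take i)).fake + ∑ j, (I.accepted w i j : ℝ) := by
    exact_mod_cast h1
  linarith

/-- What bidder `j` spends, in real money, is at most the sum of his accepted bids. -/
theorem budget_sub_left_le (w : Fin I.m → unitInterval) (j : Fin I.m) :
    (I.budget j : ℝ) - I.leftAt w I.n j ≤ ∑ i, (I.accepted w i j : ℝ) := by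
  have h := sum_fin_telescope I.n fun t => -(I.leftAt w t j : ℝ)
  have h0 : I.leftAt w 0 j = I.budget j := rfl
  rw [h0] at h
  have : ∑ i : Fin I.n, (-(I.leftAt w (i + 1) j : ℝ) - -(I.leftAt w i j : ℝ)) ≤
      ∑ i, (I.accepted w i j : ℝ) := by
    refine Finset.sum_le_sum fun i _ => ?_
    have h1 := I.leftAt_succ w i j
    have h2 : I.leftAt w i j ≤ I.leftAt w (i + 1) j + I.accepted w i j := by omega
    have h3 : (I.leftAt w i j : ℝ) ≤ I.leftAt w (i + 1) j + I.accepted w i j := by exact_mod_cast h2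
    linarith
  linarith

/-! ### Fake money -/

/-- Only an exhausted bidder `j` has paid fake money, once, and at most `bid - 1 ≤ mu * B_j`. -/
theorem fake_le_exhausted (w : Fin I.m → unitInterval) (t : ℕ) (ht : t ≤ I.n) :
    ((algorithmA3.run I.budget w (I.queries.take t)).fake : ℝ) ≤
      I.mu * ∑ j, if I.leftAt w t j = 0 then (I.budget j : ℝ) else 0 := by
  induction t with
  | zero =>
    have h0 : ((algorithmA3.run I.budget w (I.queries.take 0)).fake : ℝ) = 0 := Nat.cast_zero
    rw [h0]
    positivity
  | succ t ih =>
    have ih := ih (by omega)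
    have hsucc := I.leftAt_succ w ⟨t, ht⟩
    simp only at hsucc
    have hrun := I.take_succ_queries ⟨t, ht⟩
    simp only at hrun
    have hmono : ∀ j, (if I.leftAt w t j = 0 then (I.budget j : ℝ) else 0) ≤
        if I.leftAt w (t + 1) j = 0 then (I.budget j : ℝ) else 0 := fun j => by
      rw [hsucc]
      split_ifs with h1 h2
      · exact le_rfl
      · omega
      · exact Nat.cast_nonneg _
      · exact le_rfl
    rw [hrun, runA3_concat]
    rcases hb : bestBidder w (I.bid ⟨t, ht⟩) (I.leftAt w t) with _ | z
    · have hf : ((algorithmA3.run I.budget w (I.queries.take t)).charge (I.bid ⟨t, ht⟩)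
          (bestBidder w (I.bid ⟨t, ht⟩) (algorithmA3.run I.budget w (I.queries.take t)).left)).fake
            =
          (algorithmA3.run I.budget w (I.queries.take t)).fake := by
        rw [leftAt] at hb; rw [hb]; rfl
      rw [hf]
      exact ih.trans (mul_le_mul_of_nonneg_left (Finset.sum_le_sum fun j _ => hmono j) I.mu.2)
    · have hz := (isBest_of_bestBidder hb).1
      have hf : ((algorithmA3.run I.budget w (I.queries.take t)).charge (I.bid ⟨t, ht⟩)
          (bestBidder w (I.bid ⟨t, ht⟩) (algorithmA3.run I.budget w (I.queries.take t)).left)).fake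
            =
          (algorithmA3.run I.budget w (I.queries.take t)).fake +
            (I.bid ⟨t, ht⟩ z - I.leftAt w t z) := by
        rw [leftAt] at hb; rw [hb]; rfl
      have hacc : I.accepted w ⟨t, ht⟩ z = I.bid ⟨t, ht⟩ z := by simp [accepted, hb]
      rw [hf, ← Finset.add_sum_erase _ _ (Finset.mem_univ z)]
      rw [← Finset.add_sum_erase _ _ (Finset.mem_univ z)] at ih
      have hrest := mul_le_mul_of_nonneg_left
        (Finset.sum_le_sum fun j (_ : j ∈ Finset.univ.erase z) => hmono j) I.mu.2
      have hz0 : I.leftAt w t z ≠ 0 := hz.2.ne'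
      rw [if_neg hz0, zero_add] at ih
      rw [mul_add]
      rw [Nat.cast_add]
      have hkey : ((I.bid ⟨t, ht⟩ z - I.leftAt w t z : ℕ) : ℝ) ≤
          I.mu * if I.leftAt w (t + 1) z = 0 then (I.budget z : ℝ) else 0 := by
        rw [hsucc, hacc]
        split_ifs with h
        · refine le_trans ?_ (I.mu_ge ⟨t, ht⟩ z hz.1)
          have : I.bid ⟨t, ht⟩ z - I.leftAt w t z ≤ I.bid ⟨t, ht⟩ z - 1 := by omega
          calc ((I.bid ⟨t, ht⟩ z - I.leftAt w t z : ℕ) : ℝ) ≤ ((I.bid ⟨t, ht⟩ z - 1 : ℕ) : ℝ) := by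
                exact_mod_cast this
            _ = _ := by rw [Nat.cast_sub hz.1]; simp
        · have : I.bid ⟨t, ht⟩ z - I.leftAt w t z = 0 := by omega
          simp [this]
      have hrest' : (I.mu : ℝ) * _ ≤ I.mu * _ := hrest
      linarith

theorem fake_le_mu_mul_sum_budget (w : Fin I.m → unitInterval) :
    ((algorithmA3.run I.budget w I.queries).fake : ℝ) ≤ I.mu * ∑ j, (I.budget j : ℝ) := by
  have h := I.fake_le_exhausted w I.n le_rfl
  rw [take_length_queries] at h
  refine h.trans (mul_le_mul_of_nonneg_left (Finset.sum_le_sum fun j _ => ?_) I.mu.2)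
  split_ifs
  exacts [le_rfl, Nat.cast_nonneg _]

/-- Exhausted bidders have spent their budgets in real money, so the fake money is also small
compared with the real money; this does not need a complete instance. -/
theorem fake_le_mu_mul_real (w : Fin I.m → unitInterval) :
    ((algorithmA3.run I.budget w I.queries).fake : ℝ) ≤
      I.mu * (algorithmA3.run I.budget w I.queries).real := by
  have h := I.fake_le_exhausted w I.n le_rfl
  rw [take_length_queries] at h
  refine h.trans (mul_le_mul_of_nonneg_left ?_ I.mu.2)
  refine le_trans ?_ (algorithmA3.real_run_eq_sum I.budget w I.queries).ge
  refine Finset.sum_le_sum fun j _ => ?_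
  rw [leftAt, take_length_queries]
  have h1 : ((algorithmA3.run I.budget w I.queries).left j : ℝ) ≤ I.budget j := by
    exact_mod_cast algorithmA3.left_run_le I.budget w I.queries j
  split_ifs with h0
  · simp [h0]
  · linarith

/-! ### Revenue of a bidder and utility of a query -/

theorem threshold_le_bestBid (w : Fin I.m → unitInterval) (i : Fin I.n) (j : Fin I.m) :
    I.threshold w i j ≤ bestBid w (I.bid i) (I.leftAt w i) :=
  bestBid_le_of_subset (offers_of_update (left_run_update_le _ _ j _))

theorem threshold_update (w : Fin I.m → unitInterval) (i : Fin I.n) (j : Fin I.m)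
    (x : unitInterval) : I.threshold (Function.update w j x) i j = I.threshold w i j := by
  have he := ebid_update_rank w (I.bid i) j x
  unfold threshold bestBid
  rw [run_update_rank, he, bestBidder_congr he]

theorem threshold_nonneg (w : Fin I.m → unitInterval) (i : Fin I.n) (j : Fin I.m) :
    0 ≤ I.threshold w i j := bestBid_nonneg

/-- The condition of the No-Surpassing property for the ranks `w` and the edge `(i, j)`. -/
def NoSurpassingAt (w : Fin I.m → unitInterval) (i : Fin I.n) (j : Fin I.m) : Prop :=
  (∀ k, k ≠ j →
    Offers (I.bid i)
      (algorithmA3.run I.budget w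
        ((I.queries.take i).map fun q => Function.update q j 0)).left k →
    ebid w (I.bid i) k < ebid w (I.bid i) j) →
  ∀ k, Offers (I.bid i) (algorithmA3.run I.budget w (I.queries.take i)).left k →
    ebid w (I.bid i) k ≤ ebid w (I.bid i) j

/-- If bidder `j` beats the threshold of query `i`, then `i` goes to `j`, unless `j` has no budget
left. -/
theorem accepted_eq_bid (w : Fin I.m → unitInterval) (i : Fin I.n) (j : Fin I.m)
    (hns : I.NoSurpassingAt w i j)
    (htie : ∀ k ≠ j, ebid w (I.bid i) j ≠ ebid w (I.bid i) k)
    (hbid : 0 < I.bid i j) (hleft : 0 < I.leftAt w i j)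
    (hthr : I.threshold w i j < ebid w (I.bid i) j) : I.accepted w i j = I.bid i j := by
  have hbest : ∀ k, Offers (I.bid i) (I.leftAt w i) k →
      ebid w (I.bid i) k ≤ ebid w (I.bid i) j := by
    refine hns fun k hk hoff => lt_of_le_of_lt ?_ hthr
    rw [← ebid_update_ne hk 0]
    exact ebid_le_bestBid ⟨by rw [Function.update_of_ne hk]; exact hoff.1, hoff.2⟩
  have : bestBidder w (I.bid i) (I.leftAt w i) = some j := by
    refine bestBidder_eq_of_unique ⟨⟨hbid, hleft⟩, hbest⟩ fun k hk => ?_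
    by_contra hkj
    exact htie k hkj (le_antisymm (hk.2 j ⟨hbid, hleft⟩) (hbest k hk.1))
  simp [accepted, this]

/-- The accepted bids of `j` are worth at least the bids of his queries in the offline solution `a`
whose thresholds he beats. -/
theorem sum_beaten_le_accepted (w : Fin I.m → unitInterval) (j : Fin I.m)
    (hns : ∀ i, 0 < I.bid i j → I.NoSurpassingAt w i j)
    (htie : ∀ i, 0 < I.bid i j → ∀ k ≠ j, ebid w (I.bid i) j ≠ ebid w (I.bid i) k)
    {a : Fin I.n → Option (Fin I.m)} (ha : I.Feasible a) :
    ∑ i, (if a i = some j then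
      if I.threshold w i j < ebid w (I.bid i) j then (I.bid i j : ℝ) else 0 else 0) ≤
      ∑ i, (I.accepted w i j : ℝ) := by
  by_cases h0 : I.leftAt w I.n j = 0
  · have h1 := I.budget_sub_left_le w j
    rw [h0, Nat.cast_zero, sub_zero] at h1
    refine le_trans ?_ h1
    have h2 : ∑ i, (if a i = some j then (I.bid i j : ℝ) else 0) ≤ I.budget j := by
      exact_mod_cast ha.2 j
    refine le_trans (Finset.sum_le_sum fun i _ => ?_) h2
    split_ifs
    exacts [le_rfl, Nat.cast_nonneg _, le_rfl]
  · refine Finset.sum_le_sum fun i _ => ?_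
    split_ifs with h1 h2
    · have hb := ha.1 i j h1
      rw [I.accepted_eq_bid w i j (hns i hb) (htie i hb) hb
        ((Nat.pos_of_ne_zero h0).trans_le (I.leftAt_mono w j i.2.le le_rfl)) h2]
    · exact Nat.cast_nonneg _
    · exact Nat.cast_nonneg _

theorem sum_one_sub_price_accepted (w : Fin I.m → unitInterval) (i : Fin I.n) :
    ∑ j, (1 - Real.exp ((w j : ℝ) - 1)) * (I.accepted w i j : ℝ) =
      bestBid w (I.bid i) (I.leftAt w i) := by
  refine Finset.sum_congr rfl fun j _ => ?_
  unfold accepted ebid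
  split_ifs
  · ring
  · simp

/-- Every accepted bid splits into the revenue of the bidder (a fraction `p_j` of it) and the
utility of the query (the rest). Both are bounded below along the offline solution `a`. -/
theorem sum_le_real_add_fake (w : Fin I.m → unitInterval)
    (hns : ∀ (i : Fin I.n) (j : Fin I.m), 0 < I.bid i j → I.NoSurpassingAt w i j)
    (htie : ∀ (i : Fin I.n) (j : Fin I.m), 0 < I.bid i j →
      ∀ k ≠ j, ebid w (I.bid i) j ≠ ebid w (I.bid i) k)
    {a : Fin I.n → Option (Fin I.m)} (ha : I.Feasible a) :
    ∑ j, ∑ i, (if a i = some j then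
      Real.exp ((w j : ℝ) - 1) *
        (if I.threshold w i j < ebid w (I.bid i) j then (I.bid i j : ℝ) else 0) +
        I.threshold w i j else 0) ≤
      (algorithmA3.run I.budget w I.queries).real +
        (algorithmA3.run I.budget w I.queries).fake := by
  have hrev : ∑ j, ∑ i, (if a i = some j then Real.exp ((w j : ℝ) - 1) *
      (if I.threshold w i j < ebid w (I.bid i) j then (I.bid i j : ℝ) else 0) else 0) ≤
      ∑ j, ∑ i, Real.exp ((w j : ℝ) - 1) * (I.accepted w i j : ℝ) := by
    refine Finset.sum_le_sum fun j _ => ?_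
    have h := mul_le_mul_of_nonneg_left
      (I.sum_beaten_le_accepted w j (fun i => hns i j) (fun i => htie i j) ha)
      (Real.exp_pos ((w j : ℝ) - 1)).le
    rw [Finset.mul_sum, Finset.mul_sum] at h
    simpa only [mul_ite, mul_zero] using h
  have hutil : ∑ j, ∑ i, (if a i = some j then I.threshold w i j else 0) ≤
      ∑ i, bestBid w (I.bid i) (I.leftAt w i) := by
    rw [Finset.sum_comm]
    refine Finset.sum_le_sum fun i _ => ?_
    rcases a i with _ | z
    · simpa using bestBid_nonneg
    · simpa using I.threshold_le_bestBid w i z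
  rw [real_add_fake]
  have hsplit : ∑ i, ∑ j, (I.accepted w i j : ℝ) =
      ∑ j, ∑ i, Real.exp ((w j : ℝ) - 1) * (I.accepted w i j : ℝ) +
        ∑ i, bestBid w (I.bid i) (I.leftAt w i) := by
    rw [Finset.sum_comm (s := (Finset.univ : Finset (Fin I.m))), ← Finset.sum_add_distrib]
    refine Finset.sum_congr rfl fun i _ => ?_
    rw [← sum_one_sub_price_accepted, ← Finset.sum_add_distrib]
    exact Finset.sum_congr rfl fun j _ => by ring
  rw [hsplit]
  refine le_trans (le_of_eq ?_) (add_le_add hrev hutil)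
  rw [← Finset.sum_add_distrib]
  refine Finset.sum_congr rfl fun j _ => ?_
  rw [← Finset.sum_add_distrib]
  refine Finset.sum_congr rfl fun i _ => ?_
  split_ifs <;> simp

end Problem

/-! ### Resampling one coordinate -/

/-- Resampling one coordinate does not change a product of probability measures. -/
theorem measurePreserving_update {ι : Type*} [Fintype ι] [DecidableEq ι] {X : Type*}
    [MeasurableSpace X] (μ : Measure X) [IsProbabilityMeasure μ] (j : ι) :
    MeasurePreserving (fun z : (ι → X) × X => Function.update z.1 j z.2)
      ((Measure.pi fun _ => μ).prod μ) (Measure.pi fun _ => μ) := by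
  have hmeas : Measurable fun z : (ι → X) × X => Function.update z.1 j z.2 :=
    measurable_pi_iff.2 fun k => by
      by_cases h : k = j
      · subst h; simpa using measurable_snd
      · simp only [Function.update_of_ne h]; fun_prop
  refine ⟨hmeas, (Measure.pi_eq fun s hs => ?_).symm⟩
  rw [Measure.map_apply hmeas (MeasurableSet.univ_pi hs)]
  have h : (fun z : (ι → X) × X => Function.update z.1 j z.2) ⁻¹' Set.univ.pi s =
      (Set.univ.pi (Function.update s j Set.univ)) ×ˢ s j := by
    ext ⟨f, x⟩
    simp only [Set.mem_preimage, Set.mem_univ_pi, Set.mem_prod]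
    constructor
    · intro hf
      refine ⟨fun k => ?_, by simpa using hf j⟩
      by_cases hk : k = j
      · subst hk; simp
      · simpa [hk] using hf k
    · rintro ⟨hf, hx⟩ k
      by_cases hk : k = j
      · subst hk; simpa using hx
      · simpa [hk] using hf k
  rw [h, Measure.prod_prod, Measure.pi_pi, ← Finset.prod_erase_mul _ _ (Finset.mem_univ j),
    ← Finset.prod_erase_mul (a := j) Finset.univ (fun i => μ (s i)) (Finset.mem_univ j)]
  rw [Function.update_self, measure_univ, mul_one]
  congr 1
  refine Finset.prod_congr rfl fun k hk => ?_
  rw [Function.update_of_ne (Finset.ne_of_mem_erase hk)]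

theorem integral_ge_of_forall_update {m : ℕ} {F : (Fin m → unitInterval) → ℝ} (hF : Integrable F)
    (j : Fin m) {c : ℝ} (h : ∀ w, c ≤ ∫ x, F (Function.update w j x)) : c ≤ ∫ w, F w := by
  have hp := measurePreserving_update (volume : Measure unitInterval) j
  have hF' : Integrable F (Measure.pi fun _ => volume) := hF
  have hint := hp.integrable_comp_of_integrable hF'
  have h1 : ∫ w, F w = ∫ w : Fin m → unitInterval, ∫ x, F (Function.update w j x) := by
    change ∫ w, F w ∂(Measure.pi fun _ => volume) = _
    conv_lhs => rw [← hp.map_eq]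
    rw [integral_map hp.measurable.aemeasurable (by rw [hp.map_eq]; exact hF'.1)]
    exact integral_prod _ hint
  rw [h1]
  have h2 : ∫ _ : Fin m → unitInterval, c = c := by simp
  rw [← h2]
  exact integral_mono (integrable_const c) hint.integral_prod_left h

theorem ae_ebid_ne {m : ℕ} (q : Fin m → ℕ) {j k : Fin m} (hq : 0 < q j) (hk : k ≠ j) :
    ∀ᵐ w : Fin m → unitInterval, ebid w q j ≠ ebid w q k := by
  have hmeas : MeasurableSet {w : Fin m → unitInterval | ebid w q j = ebid w q k} :=
    measurableSet_eq_fun (by unfold ebid; fun_prop) (by unfold ebid; fun_prop)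
  have hp := measurePreserving_update (volume : Measure unitInterval) j
  rw [ae_iff]
  simp only [not_not]
  change (Measure.pi fun _ => volume) {w : Fin m → unitInterval | ebid w q j = ebid w q k} = 0
  rw [← hp.measure_preimage hmeas.nullMeasurableSet,
    Measure.measure_prod_null (hp.measurable hmeas)]
  refine Filter.Eventually.of_forall fun w => Set.Subsingleton.measure_zero ?_ _
  intro x hx y hy
  simp only [Set.mem_preimage, Set.mem_ofPred_eq, ebid, Function.update_self,
    Function.update_of_ne hk] at hx hy
  have h1 := hx.trans hy.symm
  have hq' : (q j : ℝ) ≠ 0 := by exact_mod_cast hq.ne'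
  have h2 := mul_left_cancel₀ hq' h1
  have h3 : Real.exp ((x : ℝ) - 1) = Real.exp ((y : ℝ) - 1) := by linarith
  exact Subtype.ext (by linarith [Real.exp_injective h3])

theorem integral_unitInterval (f : ℝ → ℝ) : ∫ x : unitInterval, f x = ∫ x in (0 : ℝ)..1, f x := by
  rw [integral_subtype measurableSet_Icc, integral_Icc_eq_integral_Ioc,
    intervalIntegral.integral_of_le zero_le_one]

/-- The expected revenue from one edge as a function of the rank `x` of the bidder, plus the
threshold `g`, is at least `(1 - 1/e)` times the bid `b`: the bidder beats the threshold for
`x < 1 + log (1 - g / b)`, and the prices at those ranks integrate to `(1 - 1/e) - g / b`. -/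
theorem integral_revenue_add_threshold_ge {b g : ℝ} (hb : 0 < b) (hg : 0 ≤ g) :
    (1 - 1 / Real.exp 1) * b ≤ ∫ x : unitInterval, (Real.exp ((x : ℝ) - 1) *
      (if g < b * (1 - Real.exp ((x : ℝ) - 1)) then b else 0) + g) := by
  have hle : ∀ x : unitInterval, Real.exp ((x : ℝ) - 1) ≤ 1 := fun x =>
    Real.exp_le_one_iff.2 (by linarith [x.2.2])
  have hmeas : Measurable fun x : ℝ => Real.exp (x - 1) *
      (if g < b * (1 - Real.exp (x - 1)) then b else 0) := by
    refine Measurable.mul (by fun_prop) (Measurable.ite ?_ measurable_const measurable_const)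
    exact measurableSet_lt measurable_const (by fun_prop)
  have hint : Integrable fun x : unitInterval => Real.exp ((x : ℝ) - 1) *
      (if g < b * (1 - Real.exp ((x : ℝ) - 1)) then b else 0) := by
    refine Integrable.of_bound (hmeas.comp measurable_subtype_coe).aestronglyMeasurable b
      (Filter.Eventually.of_forall fun x => ?_)
    rw [Real.norm_of_nonneg (by positivity)]
    split_ifs
    · nlinarith [hle x]
    · simpa using hb.le
  rw [integral_add hint (integrable_const g)]
  have hgc : ∫ _ : unitInterval, g = g := by simp
  rw [hgc]
  by_cases hgb : (1 - 1 / Real.exp 1) * b ≤ g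
  · have : 0 ≤ ∫ x : unitInterval, Real.exp ((x : ℝ) - 1) *
      (if g < b * (1 - Real.exp ((x : ℝ) - 1)) then b else 0) :=
      integral_nonneg fun x => by positivity
    linarith
  · push Not at hgb
    have he := Real.exp_pos 1
    have hgb' : g / b < 1 - 1 / Real.exp 1 := by rwa [div_lt_iff₀ hb]
    have hpos : 1 / Real.exp 1 < 1 - g / b := by linarith
    have hpos0 : 0 < 1 - g / b := lt_trans (by positivity) hpos
    set t : ℝ := 1 + Real.log (1 - g / b) with ht
    have ht0 : 0 ≤ t := by
      have := Real.log_le_log (by positivity) hpos.le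
      rw [one_div, Real.log_inv, Real.log_exp] at this
      linarith
    have ht1 : t ≤ 1 := by
      have : Real.log (1 - g / b) ≤ 0 :=
        Real.log_nonpos hpos0.le (by linarith [div_nonneg hg hb.le])
      linarith
    have hexpt : Real.exp (t - 1) = 1 - g / b := by
      rw [ht, add_sub_cancel_left, Real.exp_log hpos0]
    have hone : ∀ x < t, g < b * (1 - Real.exp (x - 1)) := fun x hx => by
      have : Real.exp (x - 1) < 1 - g / b := by
        rw [← hexpt]; exact Real.exp_lt_exp.2 (by linarith)
      have h2 : g / b < 1 - Real.exp (x - 1) := by linarith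
      rw [div_lt_iff₀ hb] at h2
      linarith
    have hii : ∀ u v : ℝ, 0 ≤ u → u ≤ v → v ≤ 1 → IntervalIntegrable (fun x : ℝ =>
        Real.exp (x - 1) * (if g < b * (1 - Real.exp (x - 1)) then b else 0)) volume u v := by
      intro u v hu huv hv
      rw [intervalIntegrable_iff_integrableOn_Ioc_of_le huv]
      refine Measure.integrableOn_of_bounded (M := b) measure_Ioc_lt_top.ne
        hmeas.aestronglyMeasurable ?_
      rw [ae_restrict_iff' measurableSet_Ioc]
      refine Filter.Eventually.of_forall fun x hx => ?_
      rw [Real.norm_of_nonneg (by positivity)]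
      have : Real.exp (x - 1) ≤ 1 := Real.exp_le_one_iff.2 (by linarith [hx.2])
      split_ifs
      · nlinarith
      · simpa using hb.le
    have hval : ∫ x in (0 : ℝ)..t, Real.exp (x - 1) * b = b * (1 - g / b) - b / Real.exp 1 := by
      rw [intervalIntegral.integral_mul_const, intervalIntegral.integral_comp_sub_right Real.exp,
        integral_exp, hexpt, zero_sub, Real.exp_neg]
      ring
    rw [integral_unitInterval fun x => Real.exp (x - 1) *
      (if g < b * (1 - Real.exp (x - 1)) then b else 0),
      ← intervalIntegral.integral_add_adjacent_intervals (hii 0 t le_rfl ht0 ht1)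
        (hii t 1 ht0 ht1 le_rfl)]
    have h2 : 0 ≤ ∫ x in t..1, Real.exp (x - 1) *
        (if g < b * (1 - Real.exp (x - 1)) then b else 0) :=
      intervalIntegral.integral_nonneg ht1 fun x _ => by positivity
    have h1 : ∫ x in (0 : ℝ)..t, Real.exp (x - 1) *
        (if g < b * (1 - Real.exp (x - 1)) then b else 0) =
        ∫ x in (0 : ℝ)..t, Real.exp (x - 1) * b := by
      rw [intervalIntegral.integral_of_le ht0, intervalIntegral.integral_of_le ht0,
        integral_Ioc_eq_integral_Ioo, integral_Ioc_eq_integral_Ioo]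
      refine setIntegral_congr_fun measurableSet_Ioo fun x hx => ?_
      simp only [if_pos (hone x hx.2)]
    rw [h1, hval]
    have h3 : b * (1 - g / b) = b - g := by field_simp
    rw [h3]
    have h4 : (1 - 1 / Real.exp 1) * b = b - b / Real.exp 1 := by ring
    linarith

/-! ### The competitive ratio of `algorithmA3` -/

namespace Problem

variable (I : Problem)

theorem measurable_threshold (i : Fin I.n) (j : Fin I.m) :
    Measurable fun w => I.threshold w i j := by
  unfold threshold bestBid
  refine Finset.measurable_fun_sum _ fun k _ => Measurable.ite ?_ ?_ measurable_const
  · exact algorithmA3.measurableSet_pick_run I.budget _ _ (some k)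
  · unfold ebid; fun_prop

/-- The contribution of an edge `(i, j)` of the offline solution: the revenue that `j` gets from `i`
if he beats the threshold, plus the threshold. -/
noncomputable def edgeGain (w : Fin I.m → unitInterval) (i : Fin I.n) (j : Fin I.m) : ℝ :=
  Real.exp ((w j : ℝ) - 1) *
    (if I.threshold w i j < ebid w (I.bid i) j then (I.bid i j : ℝ) else 0) + I.threshold w i j

theorem integrable_edgeGain (i : Fin I.n) (j : Fin I.m) :
    Integrable fun w => I.edgeGain w i j := by
  unfold edgeGain
  refine Integrable.add ?_ ?_
  · refine Integrable.of_bound (Measurable.aestronglyMeasurable ?_) (I.bid i j : ℝ)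
      (Filter.Eventually.of_forall fun w => ?_)
    · refine Measurable.mul (by fun_prop) (Measurable.ite ?_ measurable_const measurable_const)
      exact measurableSet_lt (I.measurable_threshold i j) (by unfold ebid; fun_prop)
    · rw [Real.norm_of_nonneg (by positivity)]
      have h1 := one_sub_price_nonneg (w j)
      have h2 : (0 : ℝ) ≤ I.bid i j := Nat.cast_nonneg _
      split_ifs
      · nlinarith
      · simp
  · refine Integrable.of_bound (I.measurable_threshold i j).aestronglyMeasurable
      (∑ k, ((Function.update (I.bid i) j 0 k : ℕ) : ℝ)) (Filter.Eventually.of_forall fun w => ?_)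
    rw [Real.norm_of_nonneg (I.threshold_nonneg w i j)]
    exact bestBid_le_sum

theorem integral_edgeGain_ge (i : Fin I.n) (j : Fin I.m) (hbid : 0 < I.bid i j) :
    (1 - 1 / Real.exp 1) * (I.bid i j : ℝ) ≤ ∫ w, I.edgeGain w i j := by
  refine integral_ge_of_forall_update (I.integrable_edgeGain i j) j fun w => ?_
  have h := integral_revenue_add_threshold_ge (b := I.bid i j) (by exact_mod_cast hbid)
    (I.threshold_nonneg w i j)
  simpa only [edgeGain, threshold_update, Function.update_self, ebid] using h

theorem opt_le_expectedRevenue (hI : I.NoSurpassing) :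
    (1 - 1 / Real.exp 1) * (I.opt : ℝ) ≤ (1 + I.mu) * algorithmA3.expectedRevenue I := by
  obtain ⟨a, ha, hw⟩ := I.exists_feasible_weight_eq_opt
  have hties : ∀ᵐ w : Fin I.m → unitInterval, ∀ (i : Fin I.n) (j : Fin I.m), 0 < I.bid i j →
      ∀ k ≠ j, ebid w (I.bid i) j ≠ ebid w (I.bid i) k := by
    simp only [ae_all_iff, Filter.eventually_imp_distrib_left]
    exact fun i j hj k hk => ae_ebid_ne _ hj hk
  have hpt : ∀ᵐ w : Fin I.m → unitInterval,
      ∑ j, ∑ i, (if a i = some j then I.edgeGain w i j else 0) ≤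
        (1 + I.mu) * ((algorithmA3.run I.budget w I.queries).real : ℝ) := by
    filter_upwards [hI, hties] with w h1 h2
    have h3 := I.sum_le_real_add_fake w h1 h2 ha
    have h4 := I.fake_le_mu_mul_real w
    unfold edgeGain
    linarith
  have hintegrable : ∀ j i, Integrable fun w => if a i = some j then I.edgeGain w i j else 0 := by
    intro j i
    split_ifs
    exacts [I.integrable_edgeGain i j, integrable_zero _ _ _]
  have hreal : Integrable fun w : Fin I.m → unitInterval =>
      ((algorithmA3.run I.budget w I.queries).real : ℝ) :=
    algorithmA3.integrable_real_run I.budget I.queries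
  have hmono := integral_mono_ae
    (integrable_finsetSum _ fun j _ => integrable_finsetSum _ fun i _ => hintegrable j i)
    (hreal.const_mul (1 + (I.mu : ℝ))) hpt
  rw [integral_const_mul, integral_finsetSum _ fun j _ =>
    integrable_finsetSum _ fun i _ => hintegrable j i] at hmono
  refine le_trans ?_ hmono
  rw [← hw, weight]
  push_cast
  rw [Finset.mul_sum]
  refine Finset.sum_le_sum fun j _ => ?_
  rw [integral_finsetSum _ fun i _ => hintegrable j i, Finset.mul_sum]
  refine Finset.sum_le_sum fun i _ => ?_
  split_ifs with h
  · exact I.integral_edgeGain_ge i j (ha.1 i j h)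
  · simp

end Problem

theorem algorithmA3_competitive :
    algorithmA3.CompetitiveForSmall {I | I.NoSurpassing} (1 - 1 / Real.exp 1) := by
  intro 𝓕 h𝓕 hsmall ε hε
  obtain ⟨N, hN⟩ := hsmall ε hε
  refine ⟨N, fun I hI hn => ?_⟩
  have hmu := hN I hI hn
  have hmu0 : (0 : ℝ) ≤ I.mu := I.mu.2
  have hopt : (0 : ℝ) ≤ I.opt := Nat.cast_nonneg _
  have h := I.opt_le_expectedRevenue (h𝓕 hI)
  have he : 0 < 1 / Real.exp 1 := by positivity
  -- As `1 - 1/e ≤ 1`, dividing by `1 + mu ≤ 1 + ε` costs at most `ε`.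
  have h1 : (1 + (I.mu : ℝ)) * ((1 - 1 / Real.exp 1 - ε) * I.opt) ≤
      (1 - 1 / Real.exp 1) * (I.opt : ℝ) := by
    have h2 : (1 + (I.mu : ℝ)) * (1 - 1 / Real.exp 1 - ε) ≤ 1 - 1 / Real.exp 1 := by
      nlinarith [mul_nonneg hmu0 he.le, mul_nonneg hmu0 hε.le]
    nlinarith [mul_le_mul_of_nonneg_right h2 hopt]
  exact le_of_mul_le_mul_left (h1.trans h) (by linarith)

/-! ### No-Surpassing for unit bids and budgets -/

/-- With unit bids and budgets, a bidder who has budget left only because `j` is present has a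
rank no better than that of `j`: along the chain of bidders who are displaced, starting with `j`,
the effective bids decrease. -/
theorem left_pos_or_rank_ge {m : ℕ} (w : Fin m → unitInterval) (j : Fin m)
    (qs : List (Fin m → ℕ)) (hq : ∀ q ∈ qs, ∀ k, q k = 0 ∨ q k = 1) :
    ∀ k ≠ j, 0 < (algorithmA3.run (fun _ => 1) w qs).left k →
      0 < (algorithmA3.run (fun _ => 1) w (qs.map fun q => Function.update q j 0)).left k ∨
        w j ≤ w k := by
  induction qs using List.reverseRecOn with
  | nil => exact fun k _ h => Or.inl h
  | append_singleton qs q ih =>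
    have ih := ih fun r hr => hq r (by simp [hr])
    have hq := hq q (by simp)
    intro k hk hpos
    have hle1 := algorithmA3.left_run_le (fun _ : Fin m => 1) w qs k
    have hmono := left_run_update_le (fun _ => 1) w j qs
    rw [runA3_concat, State.left_charge] at hpos
    rw [List.map_append, List.map_singleton, runA3_concat, State.left_charge,
      Function.update_of_ne hk]
    rcases ih k hk (by omega) with h0 | h0
    swap
    · exact Or.inr h0
    by_cases hk' : bestBidder w (Function.update q j 0) (algorithmA3.run (fun _ => 1) w
        (qs.map fun q => Function.update q j 0)).left = some k
    swap
    · rw [if_neg hk', Nat.sub_zero]; exact Or.inl h0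
    right
    have hoff' := (isBest_of_bestBidder hk').1
    have hoff := (offers_of_update hmono k hoff').1
    have hqk : q k = 1 := (hq k).resolve_left hoff.1.ne'
    obtain ⟨z, hz⟩ := exists_bestBidder (w := w) hoff
    have hzk : z ≠ k := by
      rintro rfl
      rw [if_pos hz] at hpos
      omega
    have hzb := isBest_of_bestBidder hz
    have hqz : q z = 1 := (hq z).resolve_left hzb.1.1.ne'
    -- The winner `z` in the presence of `j` has at least the effective bid of `k`.
    have hwz : w z ≤ w k := by
      have h := hzb.2 k hoff
      simp only [ebid, hqk, hqz, Nat.cast_one, one_mul] at h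
      have h' : Real.exp ((w z : ℝ) - 1) ≤ Real.exp ((w k : ℝ) - 1) := by linarith
      have h'' := Real.exp_le_exp.1 h'
      exact Subtype.coe_le_coe.1 (by linarith)
    by_cases hzj : z = j
    · exact hzj ▸ hwz
    · rcases ih z hzj hzb.1.2 with h | h
      · have h1 := bestBidder_of_subset (offers_of_update hmono) hz
          ⟨by rw [Function.update_of_ne hzj]; exact hzb.1.1, h⟩
        rw [hk'] at h1
        exact absurd (Option.some.inj h1).symm hzk
      · exact h.trans hwz

theorem noSurpassing_of_unit (I : Problem) (hB : ∀ j, I.budget j = 1)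
    (hbid : ∀ i j, I.bid i j = 0 ∨ I.bid i j = 1) : I.NoSurpassing := by
  have hB' : I.budget = fun _ => 1 := funext hB
  refine Filter.Eventually.of_forall fun w i j hij h k hk => ?_
  by_cases hkj : k = j
  · rw [hkj]
  have hqs : ∀ q ∈ I.queries.take i, ∀ k, q k = 0 ∨ q k = 1 := by
    intro q hq
    have := List.mem_of_mem_take hq
    rw [Problem.queries, List.mem_ofFn] at this
    obtain ⟨i', rfl⟩ := this
    exact hbid i'
  have hkpos := hk.2
  rw [hB'] at hkpos h
  rcases left_pos_or_rank_ge w j _ hqs k hkj hkpos with h1 | h1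
  · exact (h k hkj ⟨hk.1, h1⟩).le
  · have e1 : I.bid i k = 1 := (hbid i k).resolve_left hk.1.ne'
    have e2 : I.bid i j = 1 := (hbid i j).resolve_left hij.ne'
    have h2 : Real.exp ((w j : ℝ) - 1) ≤ Real.exp ((w k : ℝ) - 1) :=
      Real.exp_le_exp.2 (by have := Subtype.coe_le_coe.2 h1; linarith)
    simp only [ebid, e1, e2, Nat.cast_one, one_mul]
    linarith

/-! ### The adversary -/

namespace OnlineAlgorithm

variable (A : OnlineAlgorithm.{u})

/-- The expected spending of bidder `j` on the queries `qs`, for unit budgets. -/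
noncomputable def load {n : ℕ} (qs : List (Fin n → ℕ)) (j : Fin n) : ℝ :=
  ∫ ω, (1 - ((A.run (fun _ => 1) ω qs).left j : ℝ)) ∂(A.law n)

variable {n : ℕ} (qs : List (Fin n → ℕ)) (q : Fin n → ℕ) (j : Fin n)

theorem integrable_one_sub_left : Integrable
    (fun ω => 1 - ((A.run (fun _ => 1) ω qs).left j : ℝ)) (A.law n) :=
  (integrable_const _).sub (A.integrable_left_run _ qs j)

theorem load_le_one : A.load qs j ≤ 1 := by
  have h := integral_mono (A.integrable_one_sub_left qs j) (integrable_const (1 : ℝ))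
    fun ω => sub_le_self _ (Nat.cast_nonneg _)
  simpa [load] using h

theorem load_le_concat : A.load qs j ≤ A.load (qs ++ [q]) j := by
  refine integral_mono (A.integrable_one_sub_left _ j) (A.integrable_one_sub_left _ j) fun ω => ?_
  simp only [run_concat]
  exact sub_le_sub_left (by exact_mod_cast State.left_charge_le _ _ _ _) _

theorem load_concat_of_eq_zero (h : q j = 0) : A.load (qs ++ [q]) j = A.load qs j := by
  unfold load
  simp only [run_concat, State.left_charge, h, ite_self, Nat.sub_zero]

theorem sum_load : ∑ j, A.load qs j = ∫ ω, ((A.run (fun _ => 1) ω qs).real : ℝ) ∂(A.law n) := by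
  unfold load
  rw [← integral_finsetSum _ fun j _ => A.integrable_one_sub_left qs j]
  refine integral_congr_ae (Filter.Eventually.of_forall fun ω => ?_)
  simp [real_run_eq_sum]

theorem sum_load_le (hq : ∀ q ∈ qs, ∀ j, q j ≤ 1) : ∑ j, A.load qs j ≤ qs.length := by
  rw [sum_load]
  have h := integral_mono (A.integrable_real_run (fun _ => 1) qs)
    (integrable_const (qs.length : ℝ)) fun ω => by
      simpa using (Nat.cast_le (α := ℝ)).2 (A.real_run_le (fun _ => 1) ω qs hq)
  simpa using h

theorem exists_least_load (n : ℕ) (qs : List (Fin (n + 1) → ℕ)) (S : Finset (Fin (n + 1))) :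
    ∃ v, S.Nonempty → v ∈ S ∧ ∀ j ∈ S, A.load qs v ≤ A.load qs j := by
  by_cases hS : S.Nonempty
  · obtain ⟨v, hv⟩ := Finset.exists_min_image S (A.load qs) hS
    exact ⟨v, fun _ => hv⟩
  · exact ⟨0, fun h => absurd h hS⟩

/-- A bidder in `S` of least expected spending (arbitrary if `S` is empty). -/
noncomputable def leastLoaded {n : ℕ} (qs : List (Fin (n + 1) → ℕ)) (S : Finset (Fin (n + 1))) :
    Fin (n + 1) := (A.exists_least_load n qs S).choose

/-- The query with a unit bid from every bidder in `S`. -/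
def unitQuery {n : ℕ} (S : Finset (Fin n)) : Fin n → ℕ := fun j => if j ∈ S then 1 else 0

/-- The adversary against `A`, before query number `t`: the queries so far, and the bidders who are
still active. All active bidders are interested in the next query; then the one with least expected
spending is withdrawn. -/
noncomputable def adversary (n : ℕ) : ℕ → List (Fin (n + 1) → ℕ) × Finset (Fin (n + 1))
  | 0 => ([], Finset.univ)
  | t + 1 =>
    ((adversary n t).1 ++ [unitQuery (adversary n t).2],
      (adversary n t).2.erase
        (A.leastLoaded ((adversary n t).1 ++ [unitQuery (adversary n t).2]) (adversary n t).2))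

/-- The bidder withdrawn after query number `t`. -/
noncomputable def withdrawn (n t : ℕ) : Fin (n + 1) :=
  A.leastLoaded (A.adversary n (t + 1)).1 (A.adversary n t).2

theorem queries_adversary_succ (n t : ℕ) :
    (A.adversary n (t + 1)).1 = (A.adversary n t).1 ++ [unitQuery (A.adversary n t).2] := rfl

theorem active_succ (n t : ℕ) :
    (A.adversary n (t + 1)).2 = (A.adversary n t).2.erase (A.withdrawn n t) := rfl

theorem card_active_and_withdrawn (n t : ℕ) (ht : t ≤ n + 1) :
    (A.adversary n t).2.card = n + 1 - t ∧ (t < n + 1 → A.withdrawn n t ∈ (A.adversary n t).2 ∧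
      ∀ j ∈ (A.adversary n t).2,
        A.load (A.adversary n (t + 1)).1 (A.withdrawn n t) ≤
          A.load (A.adversary n (t + 1)).1 j) := by
  have hspec : ∀ t, (A.adversary n t).2.card = n + 1 - t → t < n + 1 →
      A.withdrawn n t ∈ (A.adversary n t).2 ∧ ∀ j ∈ (A.adversary n t).2,
        A.load (A.adversary n (t + 1)).1 (A.withdrawn n t) ≤
          A.load (A.adversary n (t + 1)).1 j := by
    intro t hcard htn
    exact (A.exists_least_load n (A.adversary n (t + 1)).1 (A.adversary n t).2).choose_spec
      (Finset.card_pos.1 (by omega))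
  have hcard : (A.adversary n t).2.card = n + 1 - t := by
    induction t with
    | zero => simp [adversary]
    | succ t ih =>
      rw [active_succ, Finset.card_erase_of_mem (hspec t (ih (by omega)) ht).1, ih (by omega)]
      omega
  exact ⟨hcard, hspec t hcard⟩

theorem card_active (n t : ℕ) (ht : t ≤ n + 1) : (A.adversary n t).2.card = n + 1 - t :=
  (A.card_active_and_withdrawn n t ht).1

theorem withdrawn_mem {n t : ℕ} (ht : t < n + 1) : A.withdrawn n t ∈ (A.adversary n t).2 :=
  ((A.card_active_and_withdrawn n t ht.le).2 ht).1

theorem load_withdrawn_le {n t : ℕ} (ht : t < n + 1) {j : Fin (n + 1)}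
    (hj : j ∈ (A.adversary n t).2) :
    A.load (A.adversary n (t + 1)).1 (A.withdrawn n t) ≤ A.load (A.adversary n (t + 1)).1 j :=
  ((A.card_active_and_withdrawn n t ht.le).2 ht).2 j hj

theorem active_antitone (n : ℕ) : Antitone fun t => (A.adversary n t).2 :=
  antitone_nat_of_succ_le fun _ => Finset.erase_subset _ _

theorem queries_adversary_eq_ofFn (n t : ℕ) :
    (A.adversary n t).1 = List.ofFn fun i : Fin t => unitQuery (A.adversary n i).2 := by
  induction t with
  | zero => rfl
  | succ t ih => rw [queries_adversary_succ, ih, List.ofFn_succ_last]; rfl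

theorem unitQuery_le_one {n : ℕ} (S : Finset (Fin n)) (j : Fin n) : unitQuery S j ≤ 1 := by
  unfold unitQuery; split_ifs <;> simp

/-- The total expected spending, on the queries before number `t`, of the bidders withdrawn so far.
It is final, because they get no further bids. -/
noncomputable def withdrawnLoad (n t : ℕ) : ℝ :=
  ∑ j ∈ (A.adversary n t).2ᶜ, A.load (A.adversary n t).1 j

theorem withdrawnLoad_succ {n t : ℕ} (ht : t < n + 1) :
    A.withdrawnLoad n (t + 1) =
      A.load (A.adversary n (t + 1)).1 (A.withdrawn n t) + A.withdrawnLoad n t := by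
  have hmem := A.withdrawn_mem ht
  unfold withdrawnLoad
  rw [active_succ, Finset.compl_erase, Finset.sum_insert (by simpa using hmem)]
  congr 1
  refine Finset.sum_congr rfl fun j hj => ?_
  rw [queries_adversary_succ]
  exact A.load_concat_of_eq_zero _ _ _ (by simpa [unitQuery] using hj)

/-- At most `t + 1` has been spent in total after `t + 1` queries, and every active bidder has spent
at least as much as the next one to be withdrawn. -/
theorem withdrawnLoad_add_le {n t : ℕ} (ht : t < n + 1) :
    A.withdrawnLoad n t + (n + 1 - t) * A.load (A.adversary n (t + 1)).1 (A.withdrawn n t) ≤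
      t + 1 := by
  have h1 : ∑ j, A.load (A.adversary n (t + 1)).1 j ≤ t + 1 := by
    have h := A.sum_load_le (A.adversary n (t + 1)).1 (by
      rw [queries_adversary_eq_ofFn]
      intro q hq
      rw [List.mem_ofFn] at hq
      obtain ⟨i, rfl⟩ := hq
      exact unitQuery_le_one _)
    have hl : (A.adversary n (t + 1)).1.length = t + 1 := by
      rw [queries_adversary_eq_ofFn, List.length_ofFn]
    rw [hl] at h
    exact_mod_cast h
  refine le_trans ?_ h1
  rw [← Finset.sum_compl_add_sum (A.adversary n t).2]
  refine add_le_add (Finset.sum_le_sum fun j _ => A.load_le_concat _ _ _) ?_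
  have h2 := Finset.card_nsmul_le_sum (A.adversary n t).2 (A.load (A.adversary n (t + 1)).1) _
    fun j hj => A.load_withdrawn_le ht hj
  rw [A.card_active n t ht.le, nsmul_eq_mul, Nat.cast_sub ht.le] at h2
  exact_mod_cast h2

/-- The solution of the recursion `withdrawnLoad_add_le`, with a logarithm in place of a
difference of harmonic numbers. -/
theorem withdrawnLoad_le (n t : ℕ) (ht : t ≤ n + 1) :
    A.withdrawnLoad n t ≤ t - (n + 1 - t) * Real.log ((n + 2) / (n + 2 - t)) := by
  induction t with
  | zero =>
    have h0 : ((n : ℝ) + 2) ≠ 0 := by positivity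
    simp [withdrawnLoad, adversary, h0]
  | succ t ih =>
    have ih := ih (by omega)
    have hrec := A.withdrawnLoad_add_le (n := n) (t := t) ht
    rw [A.withdrawnLoad_succ ht]
    push_cast
    obtain ⟨d, rfl⟩ : ∃ d, n = t + d := ⟨n - t, by omega⟩
    push_cast at ih hrec ⊢
    set r := A.load (A.adversary (t + d) (t + 1)).1 (A.withdrawn (t + d) t)
    set D := A.withdrawnLoad (t + d) t
    have e1 : (t : ℝ) + d + 1 - t = d + 1 := by ring
    have e2 : (t : ℝ) + d + 2 - t = d + 2 := by ring
    have e3 : (t : ℝ) + d + 1 - (t + 1) = d := by ring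
    have e4 : (t : ℝ) + d + 2 - (t + 1) = d + 1 := by ring
    rw [e1, e2] at ih
    rw [e1] at hrec
    rw [e3, e4]
    have hd : (0 : ℝ) ≤ d := Nat.cast_nonneg _
    have ht0 : (0 : ℝ) ≤ t := Nat.cast_nonneg _
    have hlog : Real.log (((t : ℝ) + d + 2) / (d + 1)) ≤
        Real.log (((t : ℝ) + d + 2) / (d + 2)) + 1 / (d + 1) := by
      rw [Real.log_div (by positivity) (by positivity),
        Real.log_div (by positivity) (by positivity)]
      have h := Real.log_le_sub_one_of_pos (show (0 : ℝ) < (d + 2) / (d + 1) by positivity)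
      rw [Real.log_div (by positivity) (by positivity)] at h
      have h' : ((d : ℝ) + 2) / (d + 1) - 1 = 1 / (d + 1) := by field_simp; ring
      linarith
    set l := Real.log (((t : ℝ) + d + 2) / (d + 2))
    refine le_trans ?_ (sub_le_sub_left (mul_le_mul_of_nonneg_left hlog hd) _)
    -- Multiplied by `d + 1`, the claim is `hrec` plus `d` times the induction hypothesis.
    refine le_of_mul_le_mul_left ?_ (show (0 : ℝ) < d + 1 by positivity)
    have h3 : ((d : ℝ) + 1) * (t + 1 - d * (l + 1 / (d + 1))) =
        (d + 1) * (t + 1) - (d + 1) * d * l - d := by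
      field_simp
      ring
    rw [h3]
    nlinarith [mul_le_mul_of_nonneg_left ih hd]

theorem withdrawnLoad_le_add {n s t : ℕ} (hst : s ≤ t) (ht : t ≤ n + 1) :
    A.withdrawnLoad n t ≤ A.withdrawnLoad n s + (t - s) := by
  induction t, hst using Nat.le_induction with
  | base => simp
  | succ t hst ih =>
    have h1 := ih (by omega)
    have h2 := A.load_le_one (A.adversary n (t + 1)).1 (A.withdrawn n t)
    rw [A.withdrawnLoad_succ ht]
    push_cast
    linarith

/-! ### The hard instances -/

/-- The instance with unit bids and budgets that the adversary builds against `A`. -/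
noncomputable def hardInstance (n : ℕ) : Problem where
  m := n + 1
  n := n + 1
  budget _ := 1
  bid i := unitQuery (A.adversary n i).2
  budget_pos _ := Nat.one_pos
  bid_le_budget _ _ := unitQuery_le_one _ _

theorem noSurpassing_hardInstance (n : ℕ) : (A.hardInstance n).NoSurpassing :=
  noSurpassing_of_unit _ (fun _ => rfl) fun i j => by
    change unitQuery _ _ = 0 ∨ unitQuery _ _ = 1
    unfold unitQuery
    split_ifs <;> simp

theorem mu_hardInstance (n : ℕ) : (A.hardInstance n).mu = 0 := by
  unfold Problem.mu
  refine le_antisymm (Finset.sup_le fun e _ => ?_) zero_le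
  have h : (A.hardInstance n).bid e.1 e.2 - 1 = 0 :=
    Nat.sub_eq_zero_of_le (unitQuery_le_one _ _)
  rw [h]
  simp

theorem withdrawn_injective (n : ℕ) :
    Function.Injective fun i : Fin (n + 1) => A.withdrawn n i := by
  have key : ∀ s t : ℕ, s < t → t < n + 1 → A.withdrawn n s ≠ A.withdrawn n t := by
    intro s t hst ht h
    have h1 : A.withdrawn n t ∈ (A.adversary n (s + 1)).2 :=
      A.active_antitone n (Nat.succ_le_of_lt hst) (A.withdrawn_mem ht)
    rw [active_succ, ← h] at h1
    exact Finset.notMem_erase _ _ h1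
  intro s t h
  rcases lt_trichotomy s t with hst | hst | hst
  · exact absurd h (key s t hst t.2)
  · exact hst
  · exact absurd h.symm (key t s hst s.2)

/-- The optimal offline solution gives every query to the bidder who is withdrawn after it. -/
theorem opt_hardInstance (n : ℕ) : (A.hardInstance n).opt = n + 1 := by
  have hbid : ∀ i : Fin (n + 1), unitQuery (A.adversary n i).2 (A.withdrawn n i) = 1 := fun i =>
    if_pos (A.withdrawn_mem i.2)
  let a : Fin (n + 1) → Option (Fin (n + 1)) := fun i => some (A.withdrawn n i)
  have hbij := Finite.injective_iff_bijective.1 (A.withdrawn_injective n)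
  have hsum : ∀ j : Fin (n + 1), ∑ i : Fin (n + 1),
      (if a i = some j then unitQuery (A.adversary n i).2 j else 0) = 1 := by
    intro j
    obtain ⟨i₀, rfl⟩ := hbij.2 j
    rw [Finset.sum_eq_single i₀]
    · simp [a, hbid]
    · intro i _ hi
      rw [if_neg]
      exact fun h => hi (hbij.1 (Option.some.inj h))
    · simp
  have hfeas : (A.hardInstance n).Feasible a := by
    refine ⟨fun i j h => ?_, fun j => (hsum j).le⟩
    rw [← Option.some.inj h]
    exact Nat.one_pos.trans_le (hbid i).ge
  apply le_antisymm
  · have h := (A.hardInstance n).opt_le_sum_budget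
    have h' : ∑ j, (A.hardInstance n).budget j = n + 1 := by
      change ∑ _ : Fin (n + 1), 1 = n + 1
      simp
    exact h.trans h'.le
  · have h := (A.hardInstance n).weight_le_opt hfeas
    have h' : (A.hardInstance n).weight a = n + 1 := by
      change ∑ j : Fin (n + 1), ∑ i : Fin (n + 1),
        (if a i = some j then unitQuery (A.adversary n i).2 j else 0) = n + 1
      simp [hsum]
    exact h'.ge.trans h

theorem complete_hardInstance (n : ℕ) : (A.hardInstance n).Complete := by
  rw [Problem.Complete, opt_hardInstance]
  change n + 1 = ∑ _ : Fin (n + 1), 1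
  simp

theorem expectedRevenue_hardInstance (n : ℕ) :
    A.expectedRevenue (A.hardInstance n) = A.withdrawnLoad n (n + 1) := by
  have hempty : (A.adversary n (n + 1)).2 = ∅ := by
    rw [← Finset.card_eq_zero, A.card_active n _ le_rfl, Nat.sub_self]
  rw [withdrawnLoad, hempty, Finset.compl_empty, sum_load, queries_adversary_eq_ofFn]
  rfl

/-- Cut the queries at the point where `d` bidders are active. -/
theorem expectedRevenue_hardInstance_le (n d : ℕ) (hd : d ≤ n + 1) :
    A.expectedRevenue (A.hardInstance n) ≤ n + 1 - d * Real.log ((n + 2) / (d + 1)) := by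
  rw [expectedRevenue_hardInstance]
  have h1 := A.withdrawnLoad_le_add (n := n) (Nat.sub_le (n + 1) d) le_rfl
  have h2 := A.withdrawnLoad_le n (n + 1 - d) (Nat.sub_le _ _)
  rw [Nat.cast_sub hd] at h1 h2
  push_cast at h1 h2
  have e1 : (n : ℝ) + 1 - (n + 1 - d) = d := by ring
  have e2 : (n : ℝ) + 2 - (n + 1 - d) = d + 1 := by ring
  rw [e1, e2] at h2
  linarith

open Filter Topology in
/-- With `d = ⌊n / e⌋` active bidders left at the cut, the bound of the previous lemma is
`(1 - 1/e) n + o(n)`. -/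
theorem tendsto_bound_hardInstance :
    Tendsto (fun n : ℕ => ((n : ℝ) + 1 - (⌊(n : ℝ) / Real.exp 1⌋₊ : ℝ) *
      Real.log ((n + 2) / ((⌊(n : ℝ) / Real.exp 1⌋₊ : ℝ) + 1))) / (n + 1)) atTop
      (𝓝 (1 - 1 / Real.exp 1)) := by
  have he := Real.exp_pos 1
  have hinv : Tendsto (fun n : ℕ => 1 / ((n : ℝ) + 1)) atTop (𝓝 0) :=
    tendsto_one_div_add_atTop_nhds_zero_nat
  have hn : Tendsto (fun n : ℕ => (n : ℝ) / (n + 1)) atTop (𝓝 1) :=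
    tendsto_natCast_div_add_atTop 1
  have hfl : Tendsto (fun n : ℕ => (⌊(n : ℝ) / Real.exp 1⌋₊ : ℝ) / n) atTop
      (𝓝 (1 / Real.exp 1)) := by
    have h := (tendsto_nat_floor_mul_div_atTop (R := ℝ) (a := 1 / Real.exp 1)
      (by positivity)).comp tendsto_natCast_atTop_atTop
    refine h.congr fun n => ?_
    rw [Function.comp_apply, one_div_mul_eq_div]
  have hd : Tendsto (fun n : ℕ => (⌊(n : ℝ) / Real.exp 1⌋₊ : ℝ) / (n + 1)) atTop
      (𝓝 (1 / Real.exp 1)) := by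
    have h := hfl.mul hn
    rw [mul_one] at h
    refine h.congr' ?_
    filter_upwards [eventually_gt_atTop 0] with n hn0
    have : (n : ℝ) ≠ 0 := by exact_mod_cast hn0.ne'
    field_simp
  have hlog : Tendsto (fun n : ℕ => Real.log ((n + 2) /
      ((⌊(n : ℝ) / Real.exp 1⌋₊ : ℝ) + 1))) atTop (𝓝 1) := by
    have h1 : Tendsto (fun n : ℕ => (1 + 1 / ((n : ℝ) + 1)) /
        ((⌊(n : ℝ) / Real.exp 1⌋₊ : ℝ) / (n + 1) + 1 / ((n : ℝ) + 1))) atTop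
        (𝓝 (Real.exp 1)) := by
      have h : Tendsto (fun n : ℕ => (1 + 1 / ((n : ℝ) + 1)) /
          ((⌊(n : ℝ) / Real.exp 1⌋₊ : ℝ) / (n + 1) + 1 / ((n : ℝ) + 1))) atTop
          (𝓝 ((1 + 0) / (1 / Real.exp 1 + 0))) :=
        (hinv.const_add 1).div (hd.add hinv) (by positivity)
      rwa [add_zero, add_zero, one_div_one_div] at h
    have h2 := h1.log he.ne'
    rw [Real.log_exp] at h2
    refine h2.congr fun n => ?_
    congr 1
    field_simp
    ring
  have h := (hd.mul hlog).const_sub 1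
  rw [mul_one] at h
  refine h.congr fun n => ?_
  field_simp

end OnlineAlgorithm

/-- On the family of its hard instances, no algorithm beats `1 - 1/e`. -/
theorem competitiveRatio_le (A : OnlineAlgorithm.{u}) (c : ℝ)
    (hA : A.CompetitiveForSmall {I | I.NoSurpassing ∧ I.Complete} c) :
    c ≤ 1 - 1 / Real.exp 1 := by
  have hcomp := hA (Set.range A.hardInstance)
    (by
      rintro _ ⟨n, rfl⟩
      exact ⟨A.noSurpassing_hardInstance n, A.complete_hardInstance n⟩)
    (by
      refine fun ε hε => ⟨0, ?_⟩
      rintro _ ⟨n, rfl⟩ _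
      rw [A.mu_hardInstance]
      simpa using hε.le)
  refine le_of_forall_pos_le_add fun ε hε => ?_
  obtain ⟨N, hN⟩ := hcomp ε hε
  rw [← sub_le_iff_le_add]
  refine ge_of_tendsto OnlineAlgorithm.tendsto_bound_hardInstance ?_
  filter_upwards [Filter.eventually_ge_atTop N] with n hn
  have h1 := hN (A.hardInstance n) ⟨n, rfl⟩ (hn.trans (Nat.le_succ n))
  have hfl : ⌊(n : ℝ) / Real.exp 1⌋₊ ≤ n + 1 := by
    refine (Nat.floor_le_floor (div_le_self (Nat.cast_nonneg n) ?_)).trans ?_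
    · exact (Real.one_lt_exp_iff.2 one_pos).le
    · simp
  have h2 := A.expectedRevenue_hardInstance_le n _ hfl
  rw [A.opt_hardInstance] at h1
  push_cast at h1
  rw [le_div_iff₀ (by positivity)]
  exact h1.trans h2

end Adwords

theorem mainTheorem6 :
    -- ratio `1 - 1/e` on the instances of SMALL with the No-Surpassing property
    Adwords.algorithmA3.CompetitiveForSmall {I | I.NoSurpassing} (1 - 1 / Real.exp 1) ∧
    -- no online algorithm does better, not even on those whose offline optimum is complete
    (∀ (A : Adwords.OnlineAlgorithm.{u}) (c : ℝ),
      A.CompetitiveForSmall {I | I.NoSurpassing ∧ I.Complete} c → c ≤ 1 - 1 / Real.exp 1) ∧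
    Adwords.algorithmA3.BudgetOblivious ∧
    -- the fake money in every run is at most `mu` times the sum of the budgets
    (∀ (I : Adwords.Problem) (w : Fin I.m → unitInterval),
      ((Adwords.algorithmA3.run I.budget w I.queries).fake : ℝ) ≤
        (I.mu : ℝ) * ∑ j, (I.budget j : ℝ)) := by
  exact ⟨Adwords.algorithmA3_competitive, Adwords.competitiveRatio_le,
    Adwords.algorithmA3_budgetOblivious, Adwords.Problem.fake_le_mu_mul_sum_budget⟩
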